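/- **Conventions.** Let $X$ be a diffeological space that is path-connected (any two points lie on the image of a common smooth path defined on an open interval), let $\bullet\in X$, let $G$ be a diffeological group, and let $\pi:E\to X$ be a diffeological principal $G$-bundle: $\pi$ is a smooth surjection, $G$ acts smoothly on $E$ from the right, $(p,g)\mapsto(p,pg)$ is a diffeomorphism from $E\times G$ onto its image in $E\times E$, and there is a diffeomorphism $X\cong E/G$ carrying $\pi(p)$ to $pG$. Let $\xi_\bullet\in E$ with $\pi(\xi_\bullet)=\bullet$. For a diffeological space $Y$, $\mathcal PY$ is the space of smooth paths $\alpha:I\to Y$, $I\subseteq\mathbb R$ an open interval, with the functional diffeology, and $\hat{\mathcal P}Y=\{(\alpha,t)\in\mathcal PY\times\mathbb R: t\in\operatorname{dom}\alpha\}$. A *connection* on a map $\pi: E\to X$ as above is a smooth map $A:\hat{\mathcal P}E\to\mathcal PE$, $(\alpha,t)\mapsto A_t\alpha$, such that (i) $\operatorname{dom}(A_t\alpha)=\operatorname{dom}\alpha$; (ii) $\pi\circ A_t\alpha=\pi\circ\alpha$; (iii) $(A_t\alpha)(t)=\alpha(t)$; (iv) $A_t(\alpha\cdot\rho)=A_t\alpha\cdot\rho(t)$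 for smooth $\rho:\operatorname{dom}\alpha\to G$; (v) $A_t(\alpha\circ f)=A_{f(t)}\alpha\circ f$ for every smooth path $f$ in $\operatorname{dom}\alpha$; (vi) $A_s(A_t\alpha)=A_t\alpha$ for all $s,t\in\operatorname{dom}\alpha$. A path $\eta\in\mathcal PE$ is *horizontal* if $A_t\eta=\eta$ for some $t$. For $(\alpha,t)\in\hat{\mathcal P}X$ and $\pi(\xi)=\alpha(t)$, a *horizontal lift* $\operatorname{hor}_A(\alpha,t,\xi)$ is a horizontal path $\eta$ with $\pi\circ\eta=\alpha$ and $\eta(t)=\xi$. Consider smooth paths $\alpha:[0,1]\to X$ that are constant near $0$ and near $1$, with the subspace diffeology of $C^\infty([0,1],X)$; extend them to $\mathbb R$ by constants when taking horizontal lifts. Write $\beta\vee\alpha$ for the concatenation ($\alpha$ first, then $\beta$), $\eta^{\leftarrow}(t)=\eta(1-t)$, and $[\alpha]$ for the class of $\alpha$ under the equivalence relation generated by $\alpha\circ f\sim\alpha$ ($f\in\operatorname{Diff}([0,1])$, $f(0)=0$, $f(1)=1$) and $\beta\vee\alpha\sim\beta\vee\eta\vee\eta^{\leftarrow}\vee\alpha$.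 Let $\mathcal F_\bullet(X)$ be the set of classes $[\alpha]$ with $\alpha(0)=\bullet$ and $\Omega_\bullet(X)$ the set of those with moreover $\alpha(1)=\bullet$, with the diffeologies induced from the quotient diffeology; $\Omega_\bullet(X)$ multiplies by $[\gamma][\sigma]=[\gamma\vee\sigma]$. For a smooth homomorphism $H:\Omega_\bullet(X)\to G$, let $\mathcal F_\bullet(X)\times_HG$ be the quotient of $\mathcal F_\bullet(X)\times G$ by $([\alpha\vee\gamma],H([\gamma])^{-1}g)\sim([\alpha],g)$, with classes $\llbracket[\alpha],g\rrbracket$, right $G$-action $\llbracket[\alpha],h\rrbracket g=\llbracket[\alpha],hg\rrbracket$ and projection $\tau_H(\llbracket[\alpha],g\rrbracket)=\alpha(1)$. **Theorem.** Let $A$ be a connection on $\pi:E\to X$. Then: 1. For every $(\alpha,t)\in\hat{\mathcal P}X$ and $\xi\in\pi^{-1}(\alpha(t))$ the horizontal lift $\operatorname{hor}_A(\alpha,t,\xi)$ exists and is unique. 2. The equation $\operatorname{hor}_A(\gamma,0,\xi_\bullet)(1)=\xi_\bullet\cdot H([\gamma])$ defines a smooth group homomorphism $H:\Omega_\bullet(X)\to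 G$, the holonomy representation of $A$ at $\xi_\bullet$. 3. The formula $$\Phi(\llbracket[\alpha],g\rrbracket)=\operatorname{hor}_A(\alpha,0,\xi_\bullet)(1)\cdot g$$ is a well-defined $G$-equivariant diffeomorphism $\Phi:\mathcal F_\bullet(X)\times_HG\to E$ with $\pi\circ\Phi=\tau_H$. 4. There is a connection $\Theta^H$ on $\tau_H$, the induced universal connection, given as follows: if $p\in\mathcal P(\mathcal F_\bullet(X)\times_HG)$, $c=\tau_H\circ p$, $r,s\in\operatorname{dom}p$ and $p(r)=\llbracket[\beta],g\rrbracket$, then $$(\Theta^H_r p)(s)=\llbracket[c^{r\to s}\vee\beta],g\rrbracket,\qquad c^{r\to s}(t)=c(ts+(1-t)r),$$ where $c^{r\to s}$ is first composed with any smooth $f:[0,1]\to[0,1]$ equal to $0$ near $0$ and to $1$ near $1$. It corresponds to $A$ under $\Phi$: $$\Phi\circ\Theta^H_r p=A_r(\Phi\circ p)\qquad\text{for all }(p,r)\in\hat{\mathcal P}(\mathcal F_\bullet(X)\times_HG).$$ -/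

import Mathlib

open Diffeology Topology ContDiff

namespace DiffRecon

/-- The Euclidean space on which the plots of a diffeology are defined. -/
abbrev Euc (n : ℕ) := EuclideanSpace ℝ (Fin n)

/-- Around every point of an open set `u` the identity extends to a smooth map into `u`; plots
on open sets can therefore be replaced, after shrinking, by plots on the whole space. -/
theorem exists_smooth_shrink {n : ℕ} (r : Euc n) {u : Set (Euc n)} (hu : IsOpen u) (hr : r ∈ u) :
    ∃ k : Euc n → Euc n, ContDiff ℝ ∞ k ∧ (∀ x, k x ∈ u) ∧ ∀ᶠ x in 𝓝 r, k x = x := by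
  obtain ⟨e, he, hball⟩ := Metric.isOpen_iff.mp hu r hr
  let b : ContDiffBump r := ⟨e / 2, e, by positivity, by linarith⟩
  refine ⟨fun x => r + b x • (x - r), ?_, ?_, ?_⟩
  · exact contDiff_const.add (b.contDiff.smul (contDiff_id.sub contDiff_const))
  · intro x
    apply hball
    by_cases hx : x ∈ Metric.ball r e
    · rw [Metric.mem_ball, dist_eq_norm] at hx ⊢
      rw [add_sub_cancel_left, norm_smul, Real.norm_of_nonneg b.nonneg]
      calc b x * ‖x - r‖ ≤ 1 * ‖x - r‖ :=
            mul_le_mul_of_nonneg_right b.le_one (norm_nonneg _)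
        _ < e := by rw [one_mul]; exact hx
    · have h0 : b x = 0 := by
        apply b.zero_of_le_dist
        simpa using hx
      simpa [h0] using he
  · filter_upwards [b.eventuallyEq_one] with x hx
    simp only [hx, Pi.one_apply, one_smul]
    abel

/-! ### Basic constructions: subspaces, products, quotients, spaces of smooth maps -/

/-- The subspace diffeology. -/
instance subtypeDiffeology {X : Type*} [DiffeologicalSpace X] {P : X → Prop} :
    DiffeologicalSpace (Subtype P) where
  plots n := {p | IsPlot (fun r => (p r : X))}
  constant_plots x := isPlot_const
  plot_reparam hp hf := isPlot_reparam hp hf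
  locality hp := DiffeologicalSpace.locality hp

/-- The product diffeology. -/
instance prodDiffeology {X Y : Type*} [DiffeologicalSpace X] [DiffeologicalSpace Y] :
    DiffeologicalSpace (X × Y) where
  plots n := {p | IsPlot (fun r => (p r).1) ∧ IsPlot (fun r => (p r).2)}
  constant_plots x := ⟨isPlot_const, isPlot_const⟩
  plot_reparam hp hf := ⟨isPlot_reparam hp.1 hf, isPlot_reparam hp.2 hf⟩
  locality hp := by
    refine ⟨DiffeologicalSpace.locality fun x => ?_, DiffeologicalSpace.locality fun x => ?_⟩
    · obtain ⟨u, h1, h2, h3⟩ := hp x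
      exact ⟨u, h1, h2, fun hfu hf => (h3 hfu hf).1⟩
    · obtain ⟨u, h1, h2, h3⟩ := hp x
      exact ⟨u, h1, h2, fun hfu hf => (h3 hfu hf).2⟩

/-- The quotient diffeology: plots are the maps that locally lift to plots. (A lift that is only
defined near `r₀` may be replaced by one on the whole space by `exists_smooth_shrink`.) -/
instance quotientDiffeology {X : Type*} [DiffeologicalSpace X] (S : Setoid X) :
    DiffeologicalSpace (Quotient S) where
  plots n := {p | ∀ r₀ : Euc n, ∃ q : Euc n → X, IsPlot q ∧
    ∀ᶠ r in 𝓝 r₀, p r = Quotient.mk S (q r)}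
  constant_plots x := by
    intro r₀
    obtain ⟨y, rfl⟩ := Quotient.exists_rep x
    exact ⟨fun _ => y, isPlot_const, Filter.Eventually.of_forall fun _ => rfl⟩
  plot_reparam {n m p f} hp hf := by
    intro r₀
    obtain ⟨q, hq, hpq⟩ := hp (f r₀)
    exact ⟨q ∘ f, isPlot_reparam hq hf, (hf.continuous.tendsto r₀).eventually hpq⟩
  locality {n p} hp := by
    intro r₀
    obtain ⟨u, hu, hru, h⟩ := hp r₀
    obtain ⟨k, hk, hku, hkid⟩ := exists_smooth_shrink r₀ hu hru
    obtain ⟨q, hq, hpq⟩ := h hku hk r₀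
    refine ⟨q, hq, ?_⟩
    filter_upwards [hpq, hkid] with r h1 h2
    rw [← h1, Function.comp_apply, h2]

/-- Smooth maps between diffeological spaces. -/
structure SmoothMap (X Y : Type*) [DiffeologicalSpace X] [DiffeologicalSpace Y] where
  toFun : X → Y
  smooth : DSmooth toFun

instance {X Y : Type*} [DiffeologicalSpace X] [DiffeologicalSpace Y] :
    CoeFun (SmoothMap X Y) (fun _ => X → Y) := ⟨SmoothMap.toFun⟩

/-- The functional diffeology on the space of smooth maps. -/
instance functionalDiffeology {X Y : Type*} [DiffeologicalSpace X] [DiffeologicalSpace Y] :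
    DiffeologicalSpace (SmoothMap X Y) where
  plots n := {p | DSmooth (fun z : Euc n × X => p z.1 z.2)}
  constant_plots f := fun _ _ hq => f.smooth _ _ hq.2
  plot_reparam {n m p f} hp hf := fun _ q hq =>
    hp _ (fun y => (f (q y).1, (q y).2)) ⟨hf.dSmooth _ _ hq.1, hq.2⟩
  locality {n p} hp := by
    intro m q hq
    have hc : ContDiff ℝ ∞ (fun y => (q y).1) := IsPlot.contDiff hq.1
    refine DiffeologicalSpace.locality fun y => ?_
    obtain ⟨u, hu, hyu, h⟩ := hp (q y).1
    refine ⟨(fun y => (q y).1) ⁻¹' u, hu.preimage hc.continuous, hyu, ?_⟩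
    intro k f hf hfs
    have h1 : DSmooth (fun z : Euc k × X => p (q (f z.1)).1 z.2) :=
      h (f := fun y => (q (f y)).1) hf (hc.comp hfs)
    exact h1 _ (fun y => (y, (q (f y)).2)) ⟨isPlot_id, isPlot_reparam hq.2 hfs⟩

/-- Diffeomorphisms: smooth maps with a smooth inverse. -/
structure Diffeo (X Y : Type*) [DiffeologicalSpace X] [DiffeologicalSpace Y]
    extends X ≃ Y where
  smooth_toFun : DSmooth toFun
  smooth_invFun : DSmooth invFun

instance {X Y : Type*} [DiffeologicalSpace X] [DiffeologicalSpace Y] :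
    CoeFun (Diffeo X Y) (fun _ => X → Y) := ⟨fun f => f.toFun⟩

/-! ### Diffeological groups and principal bundles -/

/-- A diffeological group: multiplication and inversion are smooth. -/
class DiffeologicalGroup (G : Type*) [Group G] [DiffeologicalSpace G] : Prop where
  smooth_mul : DSmooth (fun p : G × G => p.1 * p.2)
  smooth_inv : DSmooth (fun g : G => g⁻¹)

/-- The result `p · g` of a right action, encoded as an action of the opposite group. -/
abbrev ract {G E : Type*} [Group G] [MulAction Gᵐᵒᵖ E] (p : E) (g : G) : E := MulOpposite.op g • p

/-- A right action `E × G → E` which is smooth. -/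
class SmoothRightAction (G E : Type*) [Group G] [DiffeologicalSpace G] [DiffeologicalSpace E]
    [MulAction Gᵐᵒᵖ E] : Prop where
  smooth_ract : DSmooth (fun p : E × G => ract p.1 p.2)

/-- The map `(p, g) ↦ (p, p · g)`. -/
def actionGraph (G E : Type*) [Group G] [MulAction Gᵐᵒᵖ E] : E × G → E × E :=
  fun p => (p.1, ract p.1 p.2)

/-- Diffeological principal `G`-bundles `π : E → X` (the smooth right action is given). -/
structure IsPrincipalBundle (G : Type*) {E X : Type*} [Group G] [DiffeologicalSpace G]
    [DiffeologicalSpace E] [DiffeologicalSpace X] [MulAction Gᵐᵒᵖ E] (π : E → X) : Prop where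
  smooth : DSmooth π
  surjective : Function.Surjective π
  /-- `(p, g) ↦ (p, p · g)` is a diffeomorphism onto its image. -/
  graph : ∃ e : Diffeo (E × G) (Set.range (actionGraph G E)), ∀ p, (e p : E × E) = actionGraph G E p
  /-- `X` is the orbit space `E / G`, with `π` as the quotient map. -/
  orbit : ∃ e : Diffeo X (Quotient (MulAction.orbitRel Gᵐᵒᵖ E)), ∀ p, e (π p) = Quotient.mk _ p

/-! ### Path spaces -/

/-- A smooth path in `Y`, defined on an open interval of `ℝ`. -/
structure SmoothPath (Y : Type*) [DiffeologicalSpace Y] where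
  dom : Set ℝ
  isOpen_dom : IsOpen dom
  ordConnected_dom : dom.OrdConnected
  toFun : dom → Y
  smooth : DSmooth toFun

/-- The path space carries the functional diffeology (of partially defined maps): for a plot `p`,
near each `(r₀, s₀)` with `s₀ ∈ dom (p r₀)` the evaluation `(r, s) ↦ p r s` is defined and smooth
on a product `V × W` of open sets. -/
instance pathDiffeology {Y : Type*} [DiffeologicalSpace Y] : DiffeologicalSpace (SmoothPath Y) where
  plots n := {p | ∀ r₀ : Euc n, ∀ s₀ ∈ (p r₀).dom, ∃ (V : Set (Euc n)) (W : Set ℝ),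
    IsOpen V ∧ r₀ ∈ V ∧ IsOpen W ∧ s₀ ∈ W ∧ ∃ h : ∀ r ∈ V, W ⊆ (p r).dom,
      DSmooth (fun z : {z : Euc n × ℝ // z.1 ∈ V ∧ z.2 ∈ W} =>
        (p z.1.1).toFun ⟨z.1.2, h z.1.1 z.2.1 z.2.2⟩)}
  constant_plots a := fun r₀ s₀ hs =>
    ⟨Set.univ, a.dom, isOpen_univ, trivial, a.isOpen_dom, hs, fun _ _ => subset_rfl,
      fun _ _ hq => a.smooth _ _ hq.2⟩
  plot_reparam {n m p f} hp hf := by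
    intro r₀ s₀ hs
    obtain ⟨V, W, hV, hrV, hW, hsW, h, hsm⟩ := hp (f r₀) s₀ hs
    refine ⟨f ⁻¹' V, W, hV.preimage hf.continuous, hrV, hW, hsW, fun r hr => h (f r) hr, ?_⟩
    intro k q hq
    exact hsm k (fun y => ⟨(f (q y).1.1, (q y).1.2), (q y).2⟩) ⟨hf.dSmooth _ _ hq.1, hq.2⟩
  locality {n p} hp := by
    intro r₀ s₀ hs
    obtain ⟨u, hu, hru, hloc⟩ := hp r₀
    obtain ⟨k, hk, hku, hkid⟩ := exists_smooth_shrink r₀ hu hru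
    have hk0 : k r₀ = r₀ := hkid.self_of_nhds
    obtain ⟨V, W, hV, hrV, hW, hsW, h, hsm⟩ := hloc hku hk r₀ s₀
      (by rw [Function.comp_apply, hk0]; exact hs)
    obtain ⟨O, hO1, hO, hrO⟩ := eventually_nhds_iff.mp hkid
    have hdom : ∀ r ∈ V ∩ O, W ⊆ (p r).dom := fun r hr => by
      have := h r hr.1
      rwa [Function.comp_apply, hO1 r hr.2] at this
    refine ⟨V ∩ O, W, hV.inter hO, ⟨hrV, hrO⟩, hW, hsW, hdom, ?_⟩
    intro m q hq
    have h1 := hsm m (fun y => ⟨(q y).1, (q y).2.1.1, (q y).2.2⟩) hq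
    have key : ∀ (r r' : Euc n) (s : ℝ) (hrr : r' = r) (h₁ : s ∈ (p r).dom)
        (h₂ : s ∈ (p r').dom), (p r).toFun ⟨s, h₁⟩ = (p r').toFun ⟨s, h₂⟩ := by
      rintro r _ s rfl h₁ h₂
      rfl
    have h2 : ∀ y, k (q y).1.1 = (q y).1.1 := fun y => hO1 _ (q y).2.1.2
    refine (congrArg (fun w => IsPlot w) (funext fun y => ?_)).mpr h1
    exact key _ _ _ (h2 y) _ _

/-- The initialized path space: pairs `(a, t)` with `t ∈ dom a`. -/
abbrev InitPath (Y : Type*) [DiffeologicalSpace Y] := {q : SmoothPath Y × ℝ // q.2 ∈ q.1.dom}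

namespace SmoothPath

variable {Y Z : Type*} [DiffeologicalSpace Y] [DiffeologicalSpace Z]

/-- The path `f ∘ a`, for a smooth map `f`. -/
def map (a : SmoothPath Y) (f : Y → Z) (hf : DSmooth f) : SmoothPath Z where
  dom := a.dom
  isOpen_dom := a.isOpen_dom
  ordConnected_dom := a.ordConnected_dom
  toFun := f ∘ a.toFun
  smooth := hf.comp a.smooth

/-- The reparameterized path `a ∘ f`, for a smooth path `f` in the interval `dom a`. -/
def reparam (a : SmoothPath Y) (f : SmoothPath ℝ) (h : ∀ s, f.toFun s ∈ a.dom) :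
    SmoothPath Y where
  dom := f.dom
  isOpen_dom := f.isOpen_dom
  ordConnected_dom := f.ordConnected_dom
  toFun := fun s => a.toFun ⟨f.toFun s, h s⟩
  smooth := fun n p hp => a.smooth n (fun r => ⟨f.toFun (p r), h (p r)⟩) (f.smooth n p hp)

/-- The path `t ↦ a(t) · ρ(t)`. -/
def ract {G : Type*} [Group G] [DiffeologicalSpace G] [MulAction Gᵐᵒᵖ Y] [SmoothRightAction G Y]
    (a : SmoothPath Y) (ρ : SmoothMap a.dom G) : SmoothPath Y where
  dom := a.dom
  isOpen_dom := a.isOpen_dom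
  ordConnected_dom := a.ordConnected_dom
  toFun := fun s => DiffRecon.ract (a.toFun s) (ρ s)
  smooth := fun n p hp => SmoothRightAction.smooth_ract n
    (fun r => (a.toFun (p r), ρ (p r))) ⟨a.smooth n p hp, ρ.smooth n p hp⟩

end SmoothPath

/-- The initialized path `(f ∘ a, t)`. -/
def InitPath.map {Y Z : Type*} [DiffeologicalSpace Y] [DiffeologicalSpace Z]
    (q : InitPath Y) (f : Y → Z) (hf : DSmooth f) : InitPath Z :=
  ⟨(q.1.1.map f hf, q.1.2), q.2⟩

/-- `X` is path-connected: any two points lie on a common smooth path. -/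
def IsSmoothPathConnected (X : Type*) [DiffeologicalSpace X] : Prop :=
  ∀ x y : X, ∃ a : SmoothPath X, x ∈ Set.range a.toFun ∧ y ∈ Set.range a.toFun

/-! ### Connections and horizontal lifts -/

/-- A diffeological connection on `π : E → X`: a smooth map `(a, t) ↦ A_t a` from initialized
paths to paths with the listed properties. -/
structure Connection (G : Type*) {E X : Type*} [Group G] [DiffeologicalSpace G]
    [DiffeologicalSpace E] [DiffeologicalSpace X] [MulAction Gᵐᵒᵖ E] [SmoothRightAction G E]
    (π : E → X) where
  toFun : InitPath E → SmoothPath E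
  smooth : DSmooth toFun
  dom_eq : ∀ q, (toFun q).dom = q.1.1.dom
  /-- `π ∘ A_t a = π ∘ a`. -/
  lifting : ∀ (q : InitPath E) (s : ℝ) (hs : s ∈ q.1.1.dom),
    π ((toFun q).toFun ⟨s, (dom_eq q).symm ▸ hs⟩) = π (q.1.1.toFun ⟨s, hs⟩)
  /-- `(A_t a)(t) = a(t)`. -/
  basepoint : ∀ q : InitPath E,
    (toFun q).toFun ⟨q.1.2, (dom_eq q).symm ▸ q.2⟩ = q.1.1.toFun ⟨q.1.2, q.2⟩
  /-- `A_t (a · ρ) = A_t a · ρ(t)`. -/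
  equivariance : ∀ (a : SmoothPath E) (t : ℝ) (ht : t ∈ a.dom) (ρ : SmoothMap a.dom G),
    toFun ⟨(a.ract ρ, t), ht⟩ = (toFun ⟨(a, t), ht⟩).ract ⟨fun _ => ρ ⟨t, ht⟩, dSmooth_const⟩
  /-- `A_t (a ∘ f) = A_{f(t)} a ∘ f`. -/
  reparameterization : ∀ (a : SmoothPath E) (f : SmoothPath ℝ) (hf : ∀ s, f.toFun s ∈ a.dom)
    (t : ℝ) (ht : t ∈ f.dom),
    toFun ⟨(a.reparam f hf, t), ht⟩ =
      (toFun ⟨(a, f.toFun ⟨t, ht⟩), hf _⟩).reparam f (fun s => (dom_eq _).symm ▸ hf s)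
  /-- `A_s (A_t a) = A_t a` for all `s, t` in the domain of `a`. -/
  projection : ∀ (q : InitPath E) (s : ℝ) (hs : s ∈ q.1.1.dom),
    toFun ⟨(toFun q, s), (dom_eq q).symm ▸ hs⟩ = toFun q

namespace Connection

variable {G E X : Type*} [Group G] [DiffeologicalSpace G]
  [DiffeologicalSpace E] [DiffeologicalSpace X] [MulAction Gᵐᵒᵖ E] [SmoothRightAction G E]
  {π : E → X}

/-- A path `η` is horizontal if `A_t η = η` for some `t` in its domain. -/
def IsHorizontal (A : Connection G π) (η : SmoothPath E) : Prop :=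
  ∃ (t : ℝ) (ht : t ∈ η.dom), A.toFun ⟨(η, t), ht⟩ = η

/-- `η = hor_A(a, t, ξ)`: `η` is the horizontal path over `a` with `η(t) = ξ`. -/
structure IsHorizontalLift (A : Connection G π) (a : SmoothPath X) (t : ℝ) (ξ : E)
    (η : SmoothPath E) : Prop where
  dom_eq : η.dom = a.dom
  lifts : ∀ (s : ℝ) (hs : s ∈ a.dom), π (η.toFun ⟨s, dom_eq.symm ▸ hs⟩) = a.toFun ⟨s, hs⟩
  start : ∃ ht : t ∈ η.dom, η.toFun ⟨t, ht⟩ = ξ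
  horizontal : A.IsHorizontal η

end Connection

/-! ### Paths on `[0, 1]`, concatenation, retrace equivalence -/

/-- `α : [0, 1] → X` is constant near `0` and constant near `1`. -/
def IsStationary {X : Type*} (α : unitInterval → X) : Prop :=
  ∃ e : ℝ, 0 < e ∧ (∀ t : unitInterval, (t : ℝ) ≤ e → α t = α 0) ∧
    ∀ t : unitInterval, 1 - e ≤ (t : ℝ) → α t = α 1

/-- Smooth paths `[0, 1] → X` that are constant near both ends; a diffeological subspace of the
space of all smooth maps `[0, 1] → X`. -/
abbrev StPath (X : Type*) [DiffeologicalSpace X] :=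
  {α : SmoothMap unitInterval X // IsStationary α.toFun}

/-- A map from `[0, 1]` is smooth if it is locally a smooth function of the parameter. -/
theorem dSmooth_of_local {X : Type*} [DiffeologicalSpace X] {α : unitInterval → X}
    (h : ∀ t : unitInterval, ∃ U : Set ℝ, IsOpen U ∧ (t : ℝ) ∈ U ∧
      ∀ (n : ℕ) (p : Euc n → unitInterval), IsPlot p → (∀ r, (p r : ℝ) ∈ U) → IsPlot (α ∘ p)) :
    DSmooth α := by
  intro n p hp
  have hc : ContDiff ℝ ∞ (fun r => (p r : ℝ)) := IsPlot.contDiff (X := ℝ) hp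
  refine DiffeologicalSpace.locality fun x => ?_
  obtain ⟨U, hU, hxU, h1⟩ := h (p x)
  exact ⟨_, hU.preimage hc.continuous, hxU, fun {m f} hf hfs =>
    h1 m (p ∘ f) (isPlot_reparam hp hfs) hf⟩

namespace StPath

variable {X : Type*} [DiffeologicalSpace X]

/-- The starting point `α(0)`. -/
def source (α : StPath X) : X := α.1 0

/-- The end point `α(1)`. -/
def target (α : StPath X) : X := α.1 1

/-- The underlying function of the concatenation `β ∨ α`, "`β` after `α`". -/
noncomputable def concatFun {Z : Type*} (β α : unitInterval → Z) (t : unitInterval) : Z :=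
  if h : (t : ℝ) < 1 / 2 then α ⟨2 * t, by have := t.2.1; constructor <;> linarith⟩
  else β ⟨2 * t - 1, by have := t.2.2; constructor <;> linarith⟩

theorem concat_smooth (β α : StPath X) (h : α.target = β.source) :
    DSmooth (concatFun β.1.toFun α.1.toFun) := by
  obtain ⟨e, he, -, ha⟩ := α.2
  obtain ⟨d, hd, hb, -⟩ := β.2
  have h' : α.1.toFun 1 = β.1.toFun 0 := h
  refine dSmooth_of_local fun t => ?_
  rcases lt_trichotomy (t : ℝ) (1 / 2) with ht | ht | ht
  · refine ⟨Set.Iio (1 / 2), isOpen_Iio, ht, fun n p hp hpU => ?_⟩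
    have hc : ContDiff ℝ ∞ (fun r => (p r : ℝ)) := IsPlot.contDiff (X := ℝ) hp
    have h2 : IsPlot (fun r => (⟨2 * (p r : ℝ), by
        have h3 := (p r).2.1; have h4 : (p r : ℝ) < 1 / 2 := hpU r
        constructor <;> linarith⟩ : unitInterval)) :=
      ContDiff.isPlot (X := ℝ) (contDiff_const.mul hc)
    have h5 := α.1.smooth n _ h2
    refine (congrArg (fun w => IsPlot w) (funext fun r => ?_)).mpr h5
    have h6 : (p r : ℝ) < 1 / 2 := hpU r
    simp [concatFun, h6, -one_div]
  · refine ⟨Set.Ioo (1 / 2 - e / 2) (1 / 2 + d / 2), isOpen_Ioo, ⟨by linarith, by linarith⟩,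
      fun n p hp hpU => ?_⟩
    have h2 : concatFun β.1.toFun α.1.toFun ∘ p = fun _ => β.1.toFun 0 := by
      funext r
      have h3 := hpU r
      simp only [Function.comp_apply, concatFun]
      split_ifs with h4
      · rw [ha _ (by simp only; linarith [h3.1]), h']
      · exact hb _ (by simp only; linarith [h3.2])
    rw [h2]
    exact isPlot_const
  · refine ⟨Set.Ioi (1 / 2), isOpen_Ioi, ht, fun n p hp hpU => ?_⟩
    have hc : ContDiff ℝ ∞ (fun r => (p r : ℝ)) := IsPlot.contDiff (X := ℝ) hp
    have h2 : IsPlot (fun r => (⟨2 * (p r : ℝ) - 1, by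
        have h3 := (p r).2.2; have h4 : 1 / 2 < (p r : ℝ) := hpU r
        constructor <;> linarith⟩ : unitInterval)) :=
      ContDiff.isPlot (X := ℝ) ((contDiff_const.mul hc).sub contDiff_const)
    have h5 := β.1.smooth n _ h2
    refine (congrArg (fun w => IsPlot w) (funext fun r => ?_)).mpr h5
    have h6 : ¬ (p r : ℝ) < 1 / 2 := not_lt.mpr (le_of_lt (hpU r))
    simp [concatFun, h6, -one_div]

theorem concatFun_zero {Z : Type*} (β α : unitInterval → Z) : concatFun β α 0 = α 0 := by
  have h : (((0 : unitInterval) : ℝ)) < 1 / 2 := by norm_num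
  rw [concatFun, dif_pos h]
  congr 1
  ext
  simp

theorem concatFun_one {Z : Type*} (β α : unitInterval → Z) : concatFun β α 1 = β 1 := by
  have h : ¬ (((1 : unitInterval) : ℝ)) < 1 / 2 := by norm_num
  rw [concatFun, dif_neg h]
  congr 1
  ext
  norm_num

theorem concat_stationary (β α : StPath X) :
    IsStationary (concatFun β.1.toFun α.1.toFun) := by
  obtain ⟨e, he, ha, -⟩ := α.2
  obtain ⟨d, hd, -, hb⟩ := β.2
  refine ⟨min (min (e / 2) (d / 2)) (1 / 4), by positivity, fun t ht => ?_, fun t ht => ?_⟩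
  · rw [concatFun_zero]
    have h1 : (t : ℝ) ≤ e / 2 := ht.trans ((min_le_left _ _).trans (min_le_left _ _))
    have h2 : (t : ℝ) ≤ 1 / 4 := ht.trans (min_le_right _ _)
    rw [concatFun, dif_pos (by linarith)]
    exact ha _ (by simp only; linarith)
  · rw [concatFun_one]
    have h1 : min (min (e / 2) (d / 2)) (1 / 4) ≤ d / 2 :=
      (min_le_left _ _).trans (min_le_right _ _)
    have h2 : min (min (e / 2) (d / 2)) (1 / 4) ≤ 1 / 4 := min_le_right _ _
    rw [concatFun, dif_neg (by linarith)]
    exact hb _ (by simp only; linarith)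

/-- The concatenation `β ∨ α` ("`β` after `α`"): first `α(2t)`, then `β(2t - 1)`. -/
noncomputable def concat (β α : StPath X) (h : α.target = β.source) : StPath X :=
  ⟨⟨concatFun β.1.toFun α.1.toFun, concat_smooth β α h⟩, concat_stationary β α⟩

@[simp] theorem source_concat (β α : StPath X) (h : α.target = β.source) :
    (concat β α h).source = α.source := concatFun_zero _ _

@[simp] theorem target_concat (β α : StPath X) (h : α.target = β.source) :
    (concat β α h).target = β.target := concatFun_one _ _

/-- The reversed path `t ↦ α(1 - t)`. -/
def reverse (α : StPath X) : StPath X :=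
  ⟨⟨fun t => α.1 (unitInterval.symm t), fun n p hp => α.1.smooth n _
      (ContDiff.isPlot (X := ℝ) (contDiff_const.sub (IsPlot.contDiff (X := ℝ) hp)))⟩, by
    obtain ⟨e, he, h0, h1⟩ := α.2
    refine ⟨e, he, fun t ht => ?_, fun t ht => ?_⟩
    · simp only [unitInterval.symm_zero]
      exact h1 _ (by simp only [unitInterval.coe_symm_eq]; linarith)
    · simp only [unitInterval.symm_one]
      exact h0 _ (by simp only [unitInterval.coe_symm_eq]; linarith)⟩

@[simp] theorem source_reverse (α : StPath X) : α.reverse.source = α.target := by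
  simp [source, target, reverse]

@[simp] theorem target_reverse (α : StPath X) : α.reverse.target = α.source := by
  simp [source, target, reverse]

/-- `α` extended to a smooth path on all of `ℝ` by the constants `α(0)` and `α(1)`. -/
noncomputable def extend (α : StPath X) : SmoothPath X where
  dom := Set.univ
  isOpen_dom := isOpen_univ
  ordConnected_dom := Set.ordConnected_univ
  toFun := fun t => α.1 (Set.projIcc 0 1 zero_le_one (t : ℝ))
  smooth := by
    obtain ⟨e, he, h0, h1⟩ := α.2
    intro n p hp
    have hc : ContDiff ℝ ∞ (fun r => (p r : ℝ)) := IsPlot.contDiff (X := ℝ) hp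
    refine DiffeologicalSpace.locality fun x => ?_
    by_cases hx0 : (p x : ℝ) < e
    · refine ⟨_, isOpen_Iio.preimage hc.continuous, hx0, fun {m f} hf hfs => ?_⟩
      have h2 : ((fun t : (Set.univ : Set ℝ) => α.1 (Set.projIcc 0 1 zero_le_one (t : ℝ))) ∘ p) ∘ f
          = fun _ => α.1 0 := by
        funext y
        have hy : (p (f y) : ℝ) < e := hf y
        refine h0 _ ?_
        rw [Set.coe_projIcc]
        exact max_le he.le ((min_le_right _ _).trans hy.le)
      rw [h2]
      exact isPlot_const
    by_cases hx1 : 1 - e < (p x : ℝ)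
    · refine ⟨_, isOpen_Ioi.preimage hc.continuous, hx1, fun {m f} hf hfs => ?_⟩
      have h2 : ((fun t : (Set.univ : Set ℝ) => α.1 (Set.projIcc 0 1 zero_le_one (t : ℝ))) ∘ p) ∘ f
          = fun _ => α.1 1 := by
        funext y
        have hy : 1 - e < (p (f y) : ℝ) := hf y
        refine h1 _ ?_
        rw [Set.coe_projIcc]
        exact le_max_of_le_right (le_min (by linarith) hy.le)
      rw [h2]
      exact isPlot_const
    · have hx : (p x : ℝ) ∈ Set.Ioo (0 : ℝ) 1 := ⟨by linarith, by linarith⟩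
      refine ⟨_, isOpen_Ioo.preimage hc.continuous, hx, fun {m f} hf hfs => ?_⟩
      refine α.1.smooth m _ ?_
      have h2 : ContDiff ℝ ∞ (fun y => (p (f y) : ℝ)) := hc.comp hfs
      have h3 : (fun y => ((Set.projIcc 0 1 zero_le_one (p (f y) : ℝ) : unitInterval) : ℝ))
          = fun y => (p (f y) : ℝ) := by
        funext y
        have hy : (p (f y) : ℝ) ∈ Set.Ioo (0 : ℝ) 1 := hf y
        rw [Set.projIcc_of_mem _ ⟨hy.1.le, hy.2.le⟩]
      have h4 : IsPlot (fun y => (Set.projIcc 0 1 zero_le_one (p (f y) : ℝ) : unitInterval)) := by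
        change IsPlot (fun y =>
          ((Set.projIcc 0 1 zero_le_one (p (f y) : ℝ) : unitInterval) : ℝ))
        rw [h3]
        exact h2.isPlot
      exact h4

/-- The reparameterization `α ∘ f` by a diffeomorphism `f` of `[0, 1]` fixing `0` and `1`,
as a relation: `IsReparam α α'` says that `α = α' ∘ f` for such an `f`. -/
def IsReparam (α α' : StPath X) : Prop :=
  ∃ f : Diffeo unitInterval unitInterval, f 0 = 0 ∧ f 1 = 1 ∧ ∀ t, α.1 t = α'.1 (f t)

end StPath

/-- The elementary moves: reparameterization by a diffeomorphism of `[0, 1]`, and the insertion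
of a retraced path, `β ∨ α ↦ β ∨ η ∨ η⁻ ∨ α` with `η⁻(t) = η(1 - t)`. -/
inductive RetraceStep {X : Type*} [DiffeologicalSpace X] : StPath X → StPath X → Prop
  | reparam (α α' : StPath X) (h : StPath.IsReparam α α') : RetraceStep α α'
  | retrace (α β η : StPath X) (hα : α.target = η.target) (hβ : η.target = β.source) :
      RetraceStep (β.concat α (hα.trans hβ))
        (β.concat (η.concat (η.reverse.concat α (by simpa using hα)) (by simp)) (by simpa using hβ))

/-- Retrace equivalence: the equivalence relation generated by the elementary moves. -/
def retraceSetoid (X : Type*) [DiffeologicalSpace X] : Setoid (StPath X) :=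
  Relation.EqvGen.setoid RetraceStep

/-- The space `F(X)` of retrace classes of paths, with the quotient diffeology. -/
abbrev PathClass (X : Type*) [DiffeologicalSpace X] := Quotient (retraceSetoid X)

namespace PathClass

variable {X : Type*} [DiffeologicalSpace X]

/-- The class `[α]`. -/
def mk (α : StPath X) : PathClass X := Quotient.mk _ α

theorem endpoints_eq {α β : StPath X} (h : Relation.EqvGen RetraceStep α β) :
    α.source = β.source ∧ α.target = β.target := by
  induction h with
  | rel a b h =>
    cases h with
    | reparam _ _ h =>
      obtain ⟨f, h0, h1, h⟩ := h
      refine ⟨?_, ?_⟩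
      · simp only [StPath.source, h, h0]
      · simp only [StPath.target, h, h1]
    | retrace α β η hα hβ => simp
  | refl => exact ⟨rfl, rfl⟩
  | symm _ _ _ ih => exact ⟨ih.1.symm, ih.2.symm⟩
  | trans _ _ _ _ _ ih1 ih2 => exact ⟨ih1.1.trans ih2.1, ih1.2.trans ih2.2⟩

/-- The common starting point of the paths in a class. -/
def source : PathClass X → X := Quotient.lift StPath.source fun _ _ h => (endpoints_eq h).1

/-- The common end point of the paths in a class. -/
def target : PathClass X → X := Quotient.lift StPath.target fun _ _ h => (endpoints_eq h).2

theorem dSmooth_target : DSmooth (target : PathClass X → X) := by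
  intro n p hp
  refine DiffeologicalSpace.locality fun x => ?_
  obtain ⟨q, hq, hpq⟩ := hp x
  obtain ⟨O, hO1, hO, hxO⟩ := eventually_nhds_iff.mp hpq
  refine ⟨O, hO, hxO, fun {m f} hf hfs => ?_⟩
  have h1 : (target ∘ p) ∘ f = fun y => (q (f y)).1 1 := by
    funext y
    simp only [Function.comp_apply, hO1 _ (hf y)]
    rfl
  rw [h1]
  have hq' : DSmooth (fun z : Euc n × unitInterval => (q z.1).1 z.2) := hq
  exact hq' m (fun y => (f y, 1)) ⟨hfs.isPlot, isPlot_const⟩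

end PathClass

/-- The space of classes of paths that start at the base point. -/
abbrev PointedPaths {X : Type*} [DiffeologicalSpace X] (x₀ : X) :=
  {c : PathClass X // c.source = x₀}

/-- The loop space: classes of paths from the base point to itself. -/
abbrev LoopSpace {X : Type*} [DiffeologicalSpace X] (x₀ : X) :=
  {c : PathClass X // c.source = x₀ ∧ c.target = x₀}

/-- The element `[α]` of the space of pointed paths. -/
def PointedPaths.mk {X : Type*} [DiffeologicalSpace X] {x₀ : X} (α : StPath X)
    (h : α.source = x₀) : PointedPaths x₀ := ⟨PathClass.mk α, h⟩

/-- The element `[γ]` of the loop space. -/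
def LoopSpace.mk {X : Type*} [DiffeologicalSpace X] {x₀ : X} (γ : StPath X)
    (h : γ.source = x₀ ∧ γ.target = x₀) : LoopSpace x₀ := ⟨PathClass.mk γ, h⟩

/-- Smooth group homomorphisms from the loop space, whose multiplication is concatenation
`[γ] [σ] = [γ ∨ σ]`, to `G`. -/
structure LoopHom {X : Type*} [DiffeologicalSpace X] (x₀ : X)
    (G : Type*) [Group G] [DiffeologicalSpace G] where
  toFun : LoopSpace x₀ → G
  smooth : DSmooth toFun
  map_concat : ∀ (γ σ : StPath X) (hγ : γ.source = x₀ ∧ γ.target = x₀)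
    (hσ : σ.source = x₀ ∧ σ.target = x₀),
    toFun (LoopSpace.mk (γ.concat σ (hσ.2.trans hγ.1.symm))
      ⟨by simpa using hσ.1, by simpa using hγ.2⟩) =
    toFun (LoopSpace.mk γ hγ) * toFun (LoopSpace.mk σ hσ)

/-! ### The associated bundle of the path fibration and its induced universal connection -/

section Associated

variable {X : Type*} [DiffeologicalSpace X] {x₀ : X} {G : Type*} [Group G] [DiffeologicalSpace G]

/-- The relation `([α] [γ], H([γ])⁻¹ g) ∼ ([α], g)`, where the loop `γ` acts on pointed paths by
`[α] [γ] = [α ∨ γ]`. -/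
inductive AssocStep (H : LoopHom x₀ G) : PointedPaths x₀ × G → PointedPaths x₀ × G → Prop
  | act (α γ : StPath X) (hα : α.source = x₀) (hγ : γ.source = x₀ ∧ γ.target = x₀) (g : G) :
      AssocStep H
        (PointedPaths.mk (α.concat γ (hγ.2.trans hα.symm)) (by simpa using hγ.1),
          (H.toFun (LoopSpace.mk γ hγ))⁻¹ * g)
        (PointedPaths.mk α hα, g)

/-- The orbit equivalence relation of the loop space on pairs `([α], g)`. -/
def assocSetoid (H : LoopHom x₀ G) : Setoid (PointedPaths x₀ × G) :=
  Relation.EqvGen.setoid (AssocStep H)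

/-- The associated bundle, the quotient of the product of pointed paths and `G` by the action
of the loop space, with the quotient diffeology. -/
abbrev Assoc (H : LoopHom x₀ G) := Quotient (assocSetoid H)

namespace Assoc

variable (H : LoopHom x₀ G)

/-- The element `⟦c, g⟧`. -/
def mk (c : PointedPaths x₀) (g : G) : Assoc H := Quotient.mk _ (c, g)

theorem target_eq {p q : PointedPaths x₀ × G} (h : Relation.EqvGen (AssocStep H) p q) :
    p.1.1.target = q.1.1.target := by
  induction h with
  | rel a b h =>
    cases h with
    | act α γ hα hγ g => exact StPath.target_concat _ _ _
  | refl => rfl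
  | symm _ _ _ ih => exact ih.symm
  | trans _ _ _ _ _ ih1 ih2 => exact ih1.trans ih2

/-- The bundle projection `⟦[α], g⟧ ↦ α(1)`. -/
def proj : Assoc H → X :=
  Quotient.lift (fun p : PointedPaths x₀ × G => p.1.1.target) fun _ _ h => target_eq H h

theorem mul_right_rel {p q : PointedPaths x₀ × G} (h : Relation.EqvGen (AssocStep H) p q)
    (k : G) : Relation.EqvGen (AssocStep H) (p.1, p.2 * k) (q.1, q.2 * k) := by
  induction h with
  | rel a b h =>
    cases h with
    | act α γ hα hγ g =>
      refine Relation.EqvGen.rel _ _ ?_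
      simp only [mul_assoc]
      exact AssocStep.act α γ hα hγ (g * k)
  | refl => exact Relation.EqvGen.refl _
  | symm _ _ _ ih => exact ih.symm
  | trans _ _ _ _ _ ih1 ih2 => exact ih1.trans _ _ _ ih2

/-- The right action `⟦c, h⟧ · g = ⟦c, h g⟧` of `G` on the associated bundle. -/
instance : MulAction Gᵐᵒᵖ (Assoc H) where
  smul k := Quotient.map (fun p => (p.1, p.2 * k.unop)) fun _ _ h => mul_right_rel H h k.unop
  one_smul := by
    rintro ⟨c, g⟩
    exact congrArg (Quotient.mk _) (by simp)
  mul_smul := by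
    rintro k l ⟨c, g⟩
    exact congrArg (Quotient.mk _) (by simp [mul_assoc])

theorem dSmooth_mk : DSmooth (fun p : PointedPaths x₀ × G => mk H p.1 p.2) := fun _ p hp _ =>
  ⟨p, hp, Filter.Eventually.of_forall fun _ => rfl⟩

instance [DiffeologicalGroup G] : SmoothRightAction G (Assoc H) where
  smooth_ract := by
    intro n p hp r₀
    obtain ⟨q, hq, hpq⟩ := hp.1 r₀
    refine ⟨fun r => ((q r).1, (q r).2 * (p r).2), ⟨hq.1, ?_⟩, ?_⟩
    · exact DiffeologicalGroup.smooth_mul n (fun r => ((q r).2, (p r).2)) ⟨hq.2, hp.2⟩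
    · filter_upwards [hpq] with r hr
      simp only [Function.comp_apply, hr]
      rfl

theorem dSmooth_proj : DSmooth (proj H) := by
  intro n p hp
  refine DiffeologicalSpace.locality fun x => ?_
  obtain ⟨q, hq, hpq⟩ := hp x
  obtain ⟨O, hO1, hO, hxO⟩ := eventually_nhds_iff.mp hpq
  refine ⟨O, hO, hxO, fun {m f} hf hfs => ?_⟩
  have h1 : (proj H ∘ p) ∘ f = fun y => (q (f y)).1.1.target := by
    funext y
    simp only [Function.comp_apply, hO1 _ (hf y)]
    rfl
  rw [h1]
  exact PathClass.dSmooth_target m (fun y => (q (f y)).1.1) (isPlot_reparam hq.1 hfs)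

end Assoc

end Associated

/-- The segment `c^{r → s} : [0, 1] → X`, `t ↦ c(t s + (1 - t) r)`, of a smooth path `c`. -/
def SmoothPath.segment {X : Type*} [DiffeologicalSpace X] (c : SmoothPath X) (r s : ℝ)
    (hr : r ∈ c.dom) (hs : s ∈ c.dom) : SmoothMap unitInterval X where
  toFun t := c.toFun ⟨t * s + (1 - t) * r, by
    have h := c.ordConnected_dom.convex hs hr t.2.1 (sub_nonneg.mpr t.2.2)
      (add_sub_cancel (t : ℝ) 1)
    simpa only [smul_eq_mul] using h⟩
  smooth n p hp := by
    have hc : ContDiff ℝ ∞ (fun r => (p r : ℝ)) := IsPlot.contDiff (X := ℝ) hp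
    exact c.smooth n _ (ContDiff.isPlot (X := ℝ)
      ((hc.mul contDiff_const).add ((contDiff_const.sub hc).mul contDiff_const)))

/-- The path `α ∘ f`, for `f : [0, 1] → [0, 1]` smooth and constant near the ends. -/
def SmoothMap.slowed {X : Type*} [DiffeologicalSpace X] (α : SmoothMap unitInterval X)
    (f : StPath unitInterval) : StPath X :=
  ⟨⟨fun t => α (f.1 t), α.smooth.comp f.1.smooth⟩, by
    obtain ⟨e, he, h0, h1⟩ := f.2
    exact ⟨e, he, fun t ht => congrArg α.toFun (h0 t ht), fun t ht => congrArg α.toFun (h1 t ht)⟩⟩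

theorem slowed_segment_source {X : Type*} [DiffeologicalSpace X] (c : SmoothPath X) (r s : ℝ)
    (hr : r ∈ c.dom) (hs : s ∈ c.dom) (f : StPath unitInterval) (h0 : f.source = 0) :
    ((c.segment r s hr hs).slowed f).source = c.toFun ⟨r, hr⟩ := by
  have h : f.1.toFun 0 = 0 := h0
  simp [StPath.source, SmoothMap.slowed, SmoothPath.segment, h]

/-- `Θ` is the connection on the associated bundle induced by the universal connection: for a path
`p` in the associated bundle over `c = proj ∘ p` with `p(r) = ⟦[β], g⟧`, its horizontal
projection is `(Θ_r p)(s) = ⟦[c^{r → s} ∨ β], g⟧`. As path classes are represented by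
paths that are constant near the ends, `c^{r → s}` is made so by composing it with a smooth map
`f : [0, 1] → [0, 1]` which is `0` near `0` and `1` near `1`; the formula holds for every `f`. -/
def IsInducedUniversal {X : Type*} [DiffeologicalSpace X] {x₀ : X} {G : Type*} [Group G]
    [DiffeologicalSpace G] [DiffeologicalGroup G] (H : LoopHom x₀ G)
    (Θ : Connection G (Assoc.proj H)) : Prop :=
  ∀ (f : StPath unitInterval) (hf₀ : f.source = 0) (_ : f.target = 1)
    (p : SmoothPath (Assoc H)) (r : ℝ) (hr : r ∈ p.dom)
    (β : StPath X) (hβ : β.source = x₀) (g : G)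
    (hp : p.toFun ⟨r, hr⟩ = Assoc.mk H (PointedPaths.mk β hβ) g) (s : ℝ) (hs : s ∈ p.dom),
    (Θ.toFun ⟨(p, r), hr⟩).toFun ⟨s, (Θ.dom_eq ⟨(p, r), hr⟩).symm ▸ hs⟩ =
      Assoc.mk H (PointedPaths.mk
        ((((p.map _ (Assoc.dSmooth_proj H)).segment r s hr hs).slowed f).concat β
          (((congrArg (Assoc.proj H) hp).symm.trans
            (slowed_segment_source (p.map _ (Assoc.dSmooth_proj H)) r s hr hs f hf₀).symm)))
        ((StPath.source_concat _ _ _).trans hβ)) g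

/-- `H` is the holonomy representation of `A` at `ξ₀`: the horizontal lift at `ξ₀` of each loop
`γ` ends at `ξ₀ · H([γ])`. -/
def Connection.IsHolonomy {G E X : Type*} [Group G] [DiffeologicalSpace G]
    [DiffeologicalSpace E] [DiffeologicalSpace X] [MulAction Gᵐᵒᵖ E] [SmoothRightAction G E]
    {π : E → X} (A : Connection G π) {x₀ : X} (ξ₀ : E) (H : LoopHom x₀ G) : Prop :=
  ∀ (γ : StPath X) (hγ : γ.source = x₀ ∧ γ.target = x₀) (η : SmoothPath E)
    (hη : A.IsHorizontalLift γ.extend 0 ξ₀ η),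
    η.toFun ⟨1, hη.dom_eq.symm ▸ Set.mem_univ _⟩ = ract ξ₀ (H.toFun (LoopSpace.mk γ hγ))

end DiffRecon

open DiffRecon

/-! The axioms of a connection replace differential equations. Two smooth paths `η`, `κ` over the
same base path satisfy `κ = η · ρ` with `ρ` smooth, because translation in the fibres of a principal
bundle is smooth. If both are horizontal, equivariance gives `κ = A_t κ = (A_t η) · ρ(t) = η ·
ρ(t)`, so `ρ` is constant. Hence horizontal paths over one base path that meet once coincide
(`IsHorizontal.ext`). For existence, a base path lifts locally to some smooth path, `A` projects
that path to a horizontal one, and local lifts are translated to match and then glued, with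
connectedness of the interval covering the whole domain (`exists_partialLift_joining`,
`existsUnique_horizontalLift`).

Parallel transport is treated as the relation `Transports`. Reparameterization invariance of `A`
makes constant paths horizontal, so lifts are constant near both ends and can be concatenated; it
also covers reversal and reparameterization. Transport therefore depends only on the retrace class
(`transports_congr`), and the right action commutes with it, which makes the holonomy
multiplicative. Smooth dependence on parameters (`plotAt_horizontal`) comes from smoothness of `A`
on path space: locally in time, a family of horizontal lifts is a smooth family of projected paths
times a group element that does not depend on time.

Injectivity of `Φ` rests on writing `α`, up to retrace equivalence, as `β ∨ (β⁻ ∨ α)` when `α` and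
`β` have the same end point (`retrace_factor`); the bracket is a loop whose holonomy accounts for
the difference of the group components. Surjectivity and smoothness of the inverse come together: a
plot of `E` is projected to `X`, joined to the base point by a fixed path followed by radial
segments, and corrected by a smooth group factor (`exists_lift_assoc`).

The connection `Θ^H` is obtained by pulling `A` back along `Φ`, which gives all axioms and the
correspondence with `A`. The explicit formula is then a property of this pullback, since horizontal
paths restrict to horizontal lifts of segments (`transports_slowed_segment`). -/

namespace DiffRecon

/-! ### Local plots -/

section PlotAt

variable {Y Z : Type*} [DiffeologicalSpace Y] [DiffeologicalSpace Z] {n : ℕ}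

/-- `p` is a plot near the point `r`. -/
def PlotAt (p : Euc n → Y) (r : Euc n) : Prop :=
  ∃ u : Set (Euc n), IsOpen u ∧ r ∈ u ∧
    ∀ {m : ℕ} {f : Euc m → Euc n}, (∀ x, f x ∈ u) → ContDiff ℝ ∞ f → IsPlot (p ∘ f)

theorem isPlot_of_plotAt {p : Euc n → Y} (h : ∀ r, PlotAt p r) : IsPlot p :=
  DiffeologicalSpace.locality h

theorem _root_.Diffeology.IsPlot.plotAt {p : Euc n → Y} (h : IsPlot p) (r : Euc n) : PlotAt p r :=
  ⟨Set.univ, isOpen_univ, trivial, fun _ hf => isPlot_reparam h hf⟩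

theorem PlotAt.congr {p q : Euc n → Y} {r : Euc n} (h : PlotAt p r) (hpq : p =ᶠ[𝓝 r] q) :
    PlotAt q r := by
  obtain ⟨u, hu, hr, h⟩ := h
  obtain ⟨O, hO1, hO, hrO⟩ := eventually_nhds_iff.mp hpq
  refine ⟨u ∩ O, hu.inter hO, ⟨hr, hrO⟩, fun {m f} hf hfs => ?_⟩
  have h1 : q ∘ f = p ∘ f := funext fun y => (hO1 _ (hf y).2).symm
  rw [h1]
  exact h (fun y => (hf y).1) hfs

theorem PlotAt.comp_dSmooth {p : Euc n → Y} {r : Euc n} (h : PlotAt p r) {f : Y → Z}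
    (hf : DSmooth f) : PlotAt (fun x => f (p x)) r := by
  obtain ⟨u, hu, hr, h⟩ := h
  exact ⟨u, hu, hr, fun hg hgs => hf _ _ (h hg hgs)⟩

theorem PlotAt.prodMk {p : Euc n → Y} {q : Euc n → Z} {r : Euc n} (hp : PlotAt p r)
    (hq : PlotAt q r) : PlotAt (fun x => (p x, q x)) r := by
  obtain ⟨u, hu, hr, hp⟩ := hp
  obtain ⟨v, hv, hs, hq⟩ := hq
  exact ⟨u ∩ v, hu.inter hv, ⟨hr, hs⟩, fun hf hfs =>
    ⟨hp (fun x => (hf x).1) hfs, hq (fun x => (hf x).2) hfs⟩⟩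

theorem _root_.Diffeology.DSmooth.prodMk {W : Type*} [DiffeologicalSpace W] {f : W → Y} {g : W → Z}
    (hf : DSmooth f) (hg : DSmooth g) : DSmooth (fun x => (f x, g x)) :=
  fun n p hp => ⟨hf n p hp, hg n p hp⟩

theorem dSmooth_fst : DSmooth (Prod.fst : Y × Z → Y) := fun _ _ hp => hp.1

theorem dSmooth_snd : DSmooth (Prod.snd : Y × Z → Z) := fun _ _ hp => hp.2

theorem dSmooth_val {P : Y → Prop} : DSmooth (Subtype.val : Subtype P → Y) := fun _ _ hp => hp

/-- Smoothness of maps out of `ℝⁿ × ℝ` agrees with smoothness of maps out of a Euclidean space. -/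
theorem dSmooth_toEuclidean : DSmooth (fun z : Euc n × ℝ => toEuclidean z) := by
  intro m p hp
  have h1 : ContDiff ℝ ∞ (fun r => (p r).1) := IsPlot.contDiff hp.1
  have h2 : ContDiff ℝ ∞ (fun r => (p r).2) := IsPlot.contDiff (X := ℝ) hp.2
  exact ContDiff.isPlot (toEuclidean.contDiff.comp (h1.prodMk h2))

theorem dSmooth_toEuclidean_symm : DSmooth (fun z => (toEuclidean (E := Euc n × ℝ)).symm z) := by
  intro m p hp
  have h1 : ContDiff ℝ ∞ (fun r => (toEuclidean (E := Euc n × ℝ)).symm (p r)) :=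
    (toEuclidean (E := Euc n × ℝ)).symm.contDiff.comp (IsPlot.contDiff hp)
  exact ⟨ContDiff.isPlot h1.fst, ContDiff.isPlot (X := ℝ) h1.snd⟩

end PlotAt

/-! ### Smooth paths -/

namespace SmoothPath

variable {Y Z : Type*} [DiffeologicalSpace Y] [DiffeologicalSpace Z]

protected theorem ext' {a b : SmoothPath Y} (hd : a.dom = b.dom)
    (h : ∀ s (ha : s ∈ a.dom) (hb : s ∈ b.dom), a.toFun ⟨s, ha⟩ = b.toFun ⟨s, hb⟩) : a = b := by
  obtain ⟨d, h1, h2, f, h3⟩ := a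
  obtain ⟨d', h1', h2', f', h3'⟩ := b
  obtain rfl : d = d' := hd
  obtain rfl : f = f' := funext fun ⟨s, hs⟩ => h s hs hs
  rfl

theorem toFun_congr {a b : SmoothPath Y} (h : a = b) {s : ℝ} (ha : s ∈ a.dom) (hb : s ∈ b.dom) :
    a.toFun ⟨s, ha⟩ = b.toFun ⟨s, hb⟩ := by
  subst h
  rfl

/-- The inclusion of an open interval, as a smooth path in `ℝ`. -/
def incl (J : Set ℝ) (h1 : IsOpen J) (h2 : J.OrdConnected) : SmoothPath ℝ where
  dom := J
  isOpen_dom := h1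
  ordConnected_dom := h2
  toFun := fun s => s
  smooth := dSmooth_val

/-- A smooth path in `ℝ` from a smooth function, restricted to an open interval. -/
def ofContDiff (f : ℝ → ℝ) (hf : ContDiff ℝ ∞ f) (J : Set ℝ) (h1 : IsOpen J)
    (h2 : J.OrdConnected) : SmoothPath ℝ where
  dom := J
  isOpen_dom := h1
  ordConnected_dom := h2
  toFun := fun s => f s
  smooth := (ContDiff.dSmooth (X := ℝ) (Y := ℝ) hf).comp dSmooth_val

/-- A smooth map on `ℝ`, restricted to an open interval. -/
def ofDSmooth (f : ℝ → Y) (hf : DSmooth f) (J : Set ℝ) (h1 : IsOpen J)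
    (h2 : J.OrdConnected) : SmoothPath Y where
  dom := J
  isOpen_dom := h1
  ordConnected_dom := h2
  toFun := fun s => f s
  smooth := hf.comp dSmooth_val

theorem preconnected_dom (a : SmoothPath Y) : IsPreconnected a.dom :=
  a.ordConnected_dom.isPreconnected

/-- Evaluation of a plot of paths at a fixed parameter. -/
theorem plotAt_eval {n : ℕ} {p : Euc n → SmoothPath Y} (hp : IsPlot p) (r : Euc n) {s : ℝ}
    (hs : ∀ r, s ∈ (p r).dom) : PlotAt (fun r => (p r).toFun ⟨s, hs r⟩) r := by
  obtain ⟨V, W, hV, hr, hW, hsW, h, hsm⟩ := hp r s (hs r)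
  refine ⟨V, hV, hr, fun {m f} hf hfs => ?_⟩
  exact hsm m (fun y => ⟨(f y, s), hf y, hsW⟩)
    ⟨hfs.isPlot, isPlot_const⟩

end SmoothPath

/-! ### Principal bundles -/

section Ract

variable {G E : Type*} [Group G] [MulAction Gᵐᵒᵖ E]

theorem ract_mul (p : E) (g h : G) : ract p (g * h) = ract (ract p g) h := by
  simp [ract, mul_smul]

@[simp] theorem ract_one (p : E) : ract p (1 : G) = p := by simp [ract]

end Ract

section Bundle

variable {X E G : Type*} [DiffeologicalSpace X] [DiffeologicalSpace E]
  [Group G] [DiffeologicalSpace G] [MulAction Gᵐᵒᵖ E] {π : E → X}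

namespace IsPrincipalBundle

theorem proj_ract (hπ : IsPrincipalBundle G π) (p : E) (g : G) : π (ract p g) = π p := by
  obtain ⟨e, he⟩ := hπ.orbit
  apply e.injective
  change e (π (ract p g)) = e (π p)
  rw [he, he]
  exact Quotient.sound ⟨MulOpposite.op g, rfl⟩

theorem exists_ract_eq (hπ : IsPrincipalBundle G π) {p q : E} (h : π p = π q) :
    ∃ g : G, q = ract p g := by
  obtain ⟨e, he⟩ := hπ.orbit
  have h1 : e (π q) = e (π p) := by rw [h]
  rw [he, he] at h1
  obtain ⟨g, hg⟩ := Quotient.exact h1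
  exact ⟨g.unop, hg.symm⟩

theorem ract_left_injective (hπ : IsPrincipalBundle G π) {p : E} {g h : G}
    (hgh : ract p g = ract p h) : g = h := by
  obtain ⟨e, he⟩ := hπ.graph
  have h1 : e (p, g) = e (p, h) := Subtype.ext (by rw [he, he]; simp [actionGraph, hgh])
  exact congrArg Prod.snd (e.injective h1)

/-- The element of `G` which translates one point of a fibre to another one depends smoothly on the
two points. -/
theorem dSmooth_translation (hπ : IsPrincipalBundle G π) {W : Type*} [DiffeologicalSpace W]
    {p q : W → E} {g : W → G} (hp : DSmooth p) (hq : DSmooth q) (h : ∀ x, q x = ract (p x) (g x)) :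
    DSmooth g := by
  obtain ⟨e, he⟩ := hπ.graph
  intro m f hf
  have h1 : IsPlot (fun y => (⟨(p (f y), q (f y)), (p (f y), g (f y)), by simp [actionGraph, h]⟩ :
      Set.range (actionGraph G E))) := ⟨hp m f hf, hq m f hf⟩
  have h2 := (e.smooth_invFun m _ h1).2
  -- The second component of the smooth inverse of the action graph is `g` itself, since the action
  -- is free.
  refine (congrArg (fun w => IsPlot w) (funext fun y => ?_)).mpr h2
  have h3 : e.symm ⟨(p (f y), q (f y)), (p (f y), g (f y)), by simp [actionGraph, h]⟩
      = (p (f y), g (f y)) := by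
    rw [Equiv.symm_apply_eq]
    refine Subtype.ext ?_
    change _ = (e (p (f y), g (f y)) : E × E)
    rw [he]
    simp [actionGraph, h]
  exact (congrArg Prod.snd h3).symm

theorem plotAt_translation (hπ : IsPrincipalBundle G π) {n : ℕ} {p q : Euc n → E} {g : Euc n → G}
    {r : Euc n} (hp : PlotAt p r) (hq : PlotAt q r) (h : ∀ᶠ x in 𝓝 r, q x = ract (p x) (g x)) :
    PlotAt g r := by
  obtain ⟨u, hu, hr, hp⟩ := hp
  obtain ⟨v, hv, hr', hq⟩ := hq
  obtain ⟨O, hO1, hO, hrO⟩ := eventually_nhds_iff.mp h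
  refine ⟨u ∩ v ∩ O, (hu.inter hv).inter hO, ⟨⟨hr, hr'⟩, hrO⟩, fun {m f} hf hfs => ?_⟩
  exact (hπ.dSmooth_translation (p := p ∘ f) (q := q ∘ f) (g := g ∘ f)
    (hp (fun x => (hf x).1.1) hfs).dSmooth (hq (fun x => (hf x).1.2) hfs).dSmooth
    fun x => hO1 _ (hf x).2).isPlot

/-- Plots of the base lift locally to plots of the total space. -/
theorem exists_local_lift (hπ : IsPrincipalBundle G π) {n : ℕ} {c : Euc n → X} (hc : IsPlot c)
    (r : Euc n) : ∃ q : Euc n → E, IsPlot q ∧ ∀ᶠ z in 𝓝 r, π (q z) = c z := by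
  obtain ⟨e, he⟩ := hπ.orbit
  obtain ⟨q, hq, h⟩ := e.smooth_toFun n c hc r
  refine ⟨q, hq, h.mono fun z hz => ?_⟩
  apply e.injective
  change e (π (q z)) = e (c z)
  rw [he]
  exact hz.symm

theorem exists_local_lift_prod (hπ : IsPrincipalBundle G π) {n : ℕ} {c : Euc n × ℝ → X}
    (hc : DSmooth c) (z₀ : Euc n × ℝ) :
    ∃ q : Euc n × ℝ → E, DSmooth q ∧ ∀ᶠ z in 𝓝 z₀, π (q z) = c z := by
  obtain ⟨q, hq, h⟩ := hπ.exists_local_lift (hc.comp dSmooth_toEuclidean_symm).isPlot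
    (toEuclidean z₀)
  refine ⟨fun z => q (toEuclidean z), hq.dSmooth.comp dSmooth_toEuclidean, ?_⟩
  filter_upwards [toEuclidean.continuous.tendsto z₀ |>.eventually h] with z hz
  simpa using hz

/-- A smooth map `ℝ → ℝ` into an open set which is the identity near a given point. -/
theorem _root_.DiffRecon.exists_smooth_shrink_real {u : Set ℝ} (hu : IsOpen u) {t : ℝ}
    (ht : t ∈ u) : ∃ k : ℝ → ℝ, ContDiff ℝ ∞ k ∧ (∀ x, k x ∈ u) ∧ ∀ᶠ x in 𝓝 t, k x = x := by
  let L := toEuclidean (E := ℝ)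
  obtain ⟨k, hk, hku, hkid⟩ := exists_smooth_shrink (L t) (hu.preimage L.symm.continuous)
    (by simpa using ht)
  refine ⟨fun x => L.symm (k (L x)), L.symm.contDiff.comp (hk.comp L.contDiff),
    fun x => hku _, ?_⟩
  filter_upwards [(L.continuous.tendsto t).eventually hkid] with x hx
  rw [hx, L.symm_apply_apply]

/-- Lifting is available for maps defined on all of `ℝⁿ × ℝ`. Precomposing `a` with a smooth map
into its domain that is the identity near `t` makes it global, and `n = 0` supplies a trivial
parameter. -/
theorem exists_local_lift_path (hπ : IsPrincipalBundle G π) (a : SmoothPath X) {t : ℝ}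
    (ht : t ∈ a.dom) : ∃ (q : SmoothPath E) (hd : q.dom ⊆ a.dom), t ∈ q.dom ∧
      ∀ s (hs : s ∈ q.dom), π (q.toFun ⟨s, hs⟩) = a.toFun ⟨s, hd hs⟩ := by
  obtain ⟨k, hk, hku, hkid⟩ := exists_smooth_shrink_real a.isOpen_dom ht
  have hc : DSmooth (fun z : Euc 0 × ℝ => a.toFun ⟨k z.2, hku z.2⟩) := fun n p hp =>
    a.smooth n _ ((ContDiff.dSmooth (X := ℝ) (Y := ℝ) hk) n _ hp.2)
  obtain ⟨q, hq, h⟩ := hπ.exists_local_lift_prod hc (0, t)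
  have h1 : ∀ᶠ s in 𝓝 t, π (q (0, s)) = a.toFun ⟨k s, hku s⟩ :=
    ((Continuous.prodMk continuous_const continuous_id).tendsto t).eventually h
  obtain ⟨e, he, h2⟩ := Metric.eventually_nhds_iff_ball.mp
    (h1.and (hkid.and (a.isOpen_dom.mem_nhds ht)))
  have hd : Metric.ball t e ⊆ a.dom := fun s hs => (h2 s hs).2.2
  refine ⟨SmoothPath.ofDSmooth (fun s => q (0, s)) (hq.comp (DSmooth.prodMk dSmooth_const dSmooth_id'))
    (Metric.ball t e) Metric.isOpen_ball (convex_ball t e).ordConnected, hd,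
    Metric.mem_ball_self he, fun s hs => ?_⟩
  refine (h2 s hs).1.trans ?_
  congr 2
  exact (h2 s hs).2.1


end IsPrincipalBundle
end Bundle
namespace Connection

variable {X E G : Type*} [DiffeologicalSpace X] [DiffeologicalSpace E]
  [Group G] [DiffeologicalSpace G] [MulAction Gᵐᵒᵖ E] [SmoothRightAction G E] {π : E → X}

/-! ### Horizontal paths -/

theorem toFun_congr (A : Connection G π) {a b : SmoothPath E} (h : a = b) {t : ℝ} (ha : t ∈ a.dom)
    (hb : t ∈ b.dom) : A.toFun ⟨(a, t), ha⟩ = A.toFun ⟨(b, t), hb⟩ := by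
  subst h
  rfl

/-- The projection axiom `A_s A_t = A_t` makes the choice of initial time in the definition of
horizontality immaterial. -/
theorem IsHorizontal.eq {A : Connection G π} {η : SmoothPath E} (h : A.IsHorizontal η) {s : ℝ}
    (hs : s ∈ η.dom) : A.toFun ⟨(η, s), hs⟩ = η := by
  obtain ⟨t, ht, h⟩ := h
  have h1 := A.projection ⟨(η, t), ht⟩ s hs
  exact (A.toFun_congr h.symm hs _).trans (h1.trans h)

theorem isHorizontal_toFun (A : Connection G π) (q : InitPath E) : A.IsHorizontal (A.toFun q) :=
  ⟨q.1.2, (A.dom_eq q).symm ▸ q.2, A.projection q q.1.2 q.2⟩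

theorem IsHorizontal.reparam {A : Connection G π} {η : SmoothPath E} (h : A.IsHorizontal η)
    (f : SmoothPath ℝ) (hf : ∀ s, f.toFun s ∈ η.dom) {t : ℝ} (ht : t ∈ f.dom) :
    A.IsHorizontal (η.reparam f hf) := by
  refine ⟨t, ht, (A.reparameterization η f hf t ht).trans ?_⟩
  refine SmoothPath.ext' rfl fun s ha hb => ?_
  exact SmoothPath.toFun_congr (h.eq (hf ⟨t, ht⟩)) _ _

/-- The translate of a path by a fixed group element. -/
abbrev _root_.DiffRecon.SmoothPath.ractConst (η : SmoothPath E) (g : G) : SmoothPath E :=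
  η.ract ⟨fun _ => g, dSmooth_const⟩

theorem IsHorizontal.ractConst {A : Connection G π} {η : SmoothPath E} (h : A.IsHorizontal η)
    (g : G) : A.IsHorizontal (η.ractConst g) := by
  obtain ⟨t, ht, h⟩ := h
  refine ⟨t, ht, (A.equivariance η t ht _).trans ?_⟩
  refine SmoothPath.ext' (A.dom_eq _) fun s ha hb => ?_
  exact congrArg (fun p => DiffRecon.ract p g) (SmoothPath.toFun_congr h ha hb)

/-- A constant path equals its own reparameterization by the constant function `t`, and `A_t η ∘ t`
is the constant `(A_t η)(t) = η(t)`. -/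
theorem isHorizontal_of_constant (A : Connection G π) {η : SmoothPath E} {t : ℝ} (ht : t ∈ η.dom)
    (h : ∀ s, η.toFun s = η.toFun ⟨t, ht⟩) : A.IsHorizontal η := by
  let f : SmoothPath ℝ := ⟨η.dom, η.isOpen_dom, η.ordConnected_dom, fun _ => t, dSmooth_const⟩
  have h1 : η.reparam f (fun _ => ht) = η := SmoothPath.ext' rfl fun s ha hb => (h ⟨s, hb⟩).symm
  refine ⟨t, ht, ?_⟩
  have h2 := A.reparameterization η f (fun _ => ht) t ht
  rw [A.toFun_congr h1.symm ht ht, h2]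
  refine SmoothPath.ext' rfl fun s ha hb => ?_
  exact (A.basepoint ⟨(η, t), ht⟩).trans (h ⟨s, hb⟩).symm

/-- This is the source of all uniqueness statements. Smooth translation in the fibres gives `κ = η ·
ρ` with `ρ` smooth; equivariance and horizontality turn this into `κ = η · ρ(t)`, and `ρ(t) = 1`
because the paths meet at `t` and the action is free. -/
theorem IsHorizontal.ext {A : Connection G π} (hπ : IsPrincipalBundle G π) {η κ : SmoothPath E}
    (hη : A.IsHorizontal η) (hκ : A.IsHorizontal κ) (hd : η.dom = κ.dom)
    (hp : ∀ s (h1 : s ∈ η.dom) (h2 : s ∈ κ.dom), π (η.toFun ⟨s, h1⟩) = π (κ.toFun ⟨s, h2⟩))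
    {t : ℝ} (h1 : t ∈ η.dom) (h2 : t ∈ κ.dom) (ht : η.toFun ⟨t, h1⟩ = κ.toFun ⟨t, h2⟩) :
    η = κ := by
  have h3 : ∀ s : η.dom, ∃ g : G, κ.toFun ⟨s, hd ▸ s.2⟩ = ract (η.toFun s) g := fun s =>
    hπ.exists_ract_eq (hp s s.2 _)
  choose ρ hρ using h3
  have hκs : DSmooth (fun s : η.dom => κ.toFun ⟨s, hd ▸ s.2⟩) := fun n p hp =>
    κ.smooth n (fun r => ⟨p r, hd ▸ (p r).2⟩) hp
  let ρ' : SmoothMap η.dom G := ⟨ρ, hπ.dSmooth_translation η.smooth hκs hρ⟩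
  have h4 : κ = η.ract ρ' := SmoothPath.ext' hd.symm fun s ha hb => hρ ⟨s, hb⟩
  have h5 : ρ ⟨t, h1⟩ = 1 := by
    have h6 := hρ ⟨t, h1⟩
    rw [← ht] at h6
    refine hπ.ract_left_injective (p := η.toFun ⟨t, h1⟩) ?_
    rw [ract_one]
    exact h6.symm
  have h6 := A.equivariance η t h1 ρ'
  have h7 : κ = (A.toFun ⟨(η, t), h1⟩).ract ⟨fun _ => ρ' ⟨t, h1⟩, dSmooth_const⟩ :=
    ((hκ.eq h2).symm.trans (A.toFun_congr h4 h2 h1)).trans h6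
  refine SmoothPath.ext' hd fun s ha hb => ?_
  have h8 := SmoothPath.toFun_congr h7 hb ((A.dom_eq _).symm ▸ ha)
  rw [h8]
  change _ = ract _ (ρ ⟨t, h1⟩)
  rw [h5, ract_one]
  exact (SmoothPath.toFun_congr (hη.eq h1) _ _).symm

/-- Restriction of a path to a smaller open interval. -/
def _root_.DiffRecon.SmoothPath.restrict {Y : Type*} [DiffeologicalSpace Y] (η : SmoothPath Y)
    (J : Set ℝ) (hJ : IsOpen J) (hJ' : J.OrdConnected) (h : J ⊆ η.dom) : SmoothPath Y :=
  η.reparam (SmoothPath.incl J hJ hJ') fun s => h s.2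

/-- Horizontal paths over the same path, on an interval in both domains, agree if they agree at one
point. -/
theorem IsHorizontal.eqOn {A : Connection G π} (hπ : IsPrincipalBundle G π) {η κ : SmoothPath E}
    (hη : A.IsHorizontal η) (hκ : A.IsHorizontal κ) {J : Set ℝ} (hJ : IsOpen J)
    (hJ' : J.OrdConnected) (hJη : J ⊆ η.dom) (hJκ : J ⊆ κ.dom)
    (hp : ∀ s (h : s ∈ J), π (η.toFun ⟨s, hJη h⟩) = π (κ.toFun ⟨s, hJκ h⟩))
    {t : ℝ} (htJ : t ∈ J) (ht : η.toFun ⟨t, hJη htJ⟩ = κ.toFun ⟨t, hJκ htJ⟩) {s : ℝ} (hs : s ∈ J) :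
    η.toFun ⟨s, hJη hs⟩ = κ.toFun ⟨s, hJκ hs⟩ := by
  have h1 : η.restrict J hJ hJ' hJη = κ.restrict J hJ hJ' hJκ :=
    IsHorizontal.ext hπ (hη.reparam _ _ (t := t) htJ) (hκ.reparam _ _ (t := t) htJ) rfl
      (fun s h _ => hp s h) htJ htJ ht
  exact SmoothPath.toFun_congr h1 hs hs

/-- Horizontality is a local property. -/
theorem isHorizontal_of_local {A : Connection G π} (hπ : IsPrincipalBundle G π) {η : SmoothPath E}
    (hne : η.dom.Nonempty)
    (h : ∀ s ∈ η.dom, ∃ κ : SmoothPath E, s ∈ κ.dom ∧ A.IsHorizontal κ ∧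
      ∃ hd : κ.dom ⊆ η.dom, ∀ u (hu : u ∈ κ.dom), η.toFun ⟨u, hd hu⟩ = κ.toFun ⟨u, hu⟩) :
    A.IsHorizontal η := by
  obtain ⟨t, ht⟩ := hne
  refine ⟨t, ht, ?_⟩
  have hd := A.dom_eq ⟨(η, t), ht⟩
  refine SmoothPath.ext' hd fun s ha hs => ?_
  -- Near each point both `A_t η` and `η` are compared with a horizontal `κ`, so agreement at one
  -- point of its domain spreads over that domain. Connectedness carries agreement from `t` to `s`.
  let T : ℝ → Prop := fun s => ∀ hs : s ∈ η.dom,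
    (A.toFun ⟨(η, t), ht⟩).toFun ⟨s, hd.symm ▸ hs⟩ = η.toFun ⟨s, hs⟩
  have key : T t ↔ T s := by
    refine η.preconnected_dom.induction₂ (fun x y => T x ↔ T y) ?_
      (fun _ _ _ _ _ _ => Iff.trans) (fun _ _ _ _ => Iff.symm) ht hs
    intro x hx
    obtain ⟨κ, hxκ, hκ, hκd, hκe⟩ := h x hx
    have main : ∀ y ∈ κ.dom, ∀ z ∈ κ.dom, T y → T z := by
      intro y hy z hz hTy hz'
      rw [hκe z hz]
      refine IsHorizontal.eqOn hπ (A.isHorizontal_toFun _) hκ κ.isOpen_dom κ.ordConnected_dom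
        (hκd.trans hd.symm.subset) subset_rfl (fun u hu => ?_) hy ?_ hz
      · rw [← hκe u hu]
        exact A.lifting ⟨(η, t), ht⟩ u (hκd hu)
      · rw [← hκe y hy]
        exact hTy (hκd hy)
    filter_upwards [mem_nhdsWithin_of_mem_nhds (κ.isOpen_dom.mem_nhds hxκ)] with y hy
    exact ⟨main x hxκ y hy, main y hy x hxκ⟩
  exact key.mp (fun _ => A.basepoint ⟨(η, t), ht⟩) hs

/-- Horizontal paths that agree on overlaps glue to a horizontal path. -/
theorem exists_glue {A : Connection G π} (hπ : IsPrincipalBundle G π) {ι : Type*}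
    (κ : ι → SmoothPath E) (hκ : ∀ i, A.IsHorizontal (κ i))
    (hc : ∀ i j s (hi : s ∈ (κ i).dom) (hj : s ∈ (κ j).dom),
      (κ i).toFun ⟨s, hi⟩ = (κ j).toFun ⟨s, hj⟩)
    {U : Set ℝ} (hU : ∀ s, s ∈ U ↔ ∃ i, s ∈ (κ i).dom) (hU' : U.OrdConnected) (hne : U.Nonempty) :
    ∃ η : SmoothPath E, ∃ hd : η.dom = U, A.IsHorizontal η ∧
      ∀ i s (hs : s ∈ (κ i).dom), η.toFun ⟨s, hd.symm ▸ (hU s).mpr ⟨i, hs⟩⟩ = (κ i).toFun ⟨s, hs⟩ := by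
  have h1 : ∀ s : U, ∃ i, (s : ℝ) ∈ (κ i).dom := fun s => (hU s).mp s.2
  choose i hi using h1
  have hUo : IsOpen U := by
    have : U = ⋃ i, (κ i).dom := by ext s; simp [hU]
    rw [this]
    exact isOpen_iUnion fun i => (κ i).isOpen_dom
  let f : U → E := fun s => (κ (i s)).toFun ⟨s, hi s⟩
  have hf : ∀ j s (hs : s ∈ (κ j).dom), f ⟨s, (hU s).mpr ⟨j, hs⟩⟩ = (κ j).toFun ⟨s, hs⟩ :=
    fun j s hs => hc _ _ _ _ _
  let η : SmoothPath E :=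
    { dom := U
      isOpen_dom := hUo
      ordConnected_dom := hU'
      toFun := f
      smooth := by
        intro n p hp
        have hpc : ContDiff ℝ ∞ (fun r => (p r : ℝ)) := IsPlot.contDiff (X := ℝ) hp
        refine DiffeologicalSpace.locality fun x => ?_
        refine ⟨_, (κ (i (p x))).isOpen_dom.preimage hpc.continuous, hi (p x),
          fun {m g} hg hgs => ?_⟩
        have h2 := (κ (i (p x))).smooth m (fun y => ⟨p (g y), hg y⟩) (isPlot_reparam hp hgs)
        refine (congrArg (fun w => IsPlot w) (funext fun y => ?_)).mpr h2
        exact hf (i (p x)) (p (g y)) (hg y) }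
  refine ⟨η, rfl, isHorizontal_of_local hπ hne fun s hs => ?_, hf⟩
  exact ⟨κ (i ⟨s, hs⟩), hi ⟨s, hs⟩, hκ _, fun u hu => (hU u).mpr ⟨_, hu⟩, fun u hu => hf _ u hu⟩

/-! ### Existence and uniqueness of horizontal lifts -/

/-- `η` is a horizontal path over a part of the path `a`. -/
structure IsPartialLift (A : Connection G π) (a : SmoothPath X) (η : SmoothPath E) : Prop where
  dom_subset : η.dom ⊆ a.dom
  lifts : ∀ s (hs : s ∈ η.dom), π (η.toFun ⟨s, hs⟩) = a.toFun ⟨s, dom_subset hs⟩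
  horizontal : A.IsHorizontal η

theorem IsPartialLift.ractConst {A : Connection G π} (hπ : IsPrincipalBundle G π)
    {a : SmoothPath X} {η : SmoothPath E} (h : A.IsPartialLift a η) (g : G) :
    A.IsPartialLift a (η.ractConst g) :=
  ⟨h.dom_subset, fun s hs => (hπ.proj_ract _ _).trans (h.lifts s hs), h.horizontal.ractConst g⟩

theorem IsPartialLift.exists_ractConst {A : Connection G π} (hπ : IsPrincipalBundle G π)
    {a : SmoothPath X} {η : SmoothPath E} (h : A.IsPartialLift a η) {t : ℝ} (ht : t ∈ η.dom) {ξ : E}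
    (hξ : π ξ = a.toFun ⟨t, h.dom_subset ht⟩) :
    ∃ κ : SmoothPath E, κ.dom = η.dom ∧ A.IsPartialLift a κ ∧ ∃ ht : t ∈ κ.dom,
      κ.toFun ⟨t, ht⟩ = ξ := by
  obtain ⟨g, hg⟩ := hπ.exists_ract_eq ((h.lifts t ht).trans hξ.symm)
  exact ⟨η.ractConst g, rfl, h.ractConst hπ g, ht, hg.symm⟩

theorem IsPartialLift.eqOn {A : Connection G π} (hπ : IsPrincipalBundle G π)
    {a : SmoothPath X} {η κ : SmoothPath E} (hη : A.IsPartialLift a η) (hκ : A.IsPartialLift a κ)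
    {t : ℝ} (h1 : t ∈ η.dom) (h2 : t ∈ κ.dom) (ht : η.toFun ⟨t, h1⟩ = κ.toFun ⟨t, h2⟩)
    {s : ℝ} (h3 : s ∈ η.dom) (h4 : s ∈ κ.dom) : η.toFun ⟨s, h3⟩ = κ.toFun ⟨s, h4⟩ :=
  IsHorizontal.eqOn hπ hη.horizontal hκ.horizontal (η.isOpen_dom.inter κ.isOpen_dom)
    (η.ordConnected_dom.inter κ.ordConnected_dom) Set.inter_subset_left Set.inter_subset_right
    (fun s h => (hη.lifts s h.1).trans (hκ.lifts s h.2).symm) ⟨h1, h2⟩ ht ⟨h3, h4⟩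

theorem exists_partialLift_near (A : Connection G π) (hπ : IsPrincipalBundle G π)
    (a : SmoothPath X) {t : ℝ} (ht : t ∈ a.dom) : ∃ η, A.IsPartialLift a η ∧ t ∈ η.dom := by
  obtain ⟨q, hd, htq, hq⟩ := hπ.exists_local_lift_path a ht
  have hd' := A.dom_eq ⟨(q, t), htq⟩
  refine ⟨A.toFun ⟨(q, t), htq⟩, ⟨hd'.subset.trans hd, fun s hs => ?_, A.isHorizontal_toFun _⟩,
    hd'.symm ▸ htq⟩
  exact (A.lifting ⟨(q, t), htq⟩ s (hd' ▸ hs)).trans (hq s _)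

/-- Being joined by one partial lift is a symmetric, transitive relation on the interval that holds
between nearby points, hence between any two. -/
theorem exists_partialLift_joining (A : Connection G π) (hπ : IsPrincipalBundle G π)
    (a : SmoothPath X) {t s : ℝ} (ht : t ∈ a.dom) (hs : s ∈ a.dom) :
    ∃ η, A.IsPartialLift a η ∧ t ∈ η.dom ∧ s ∈ η.dom := by
  refine a.preconnected_dom.induction₂
    (fun x y => ∃ η, A.IsPartialLift a η ∧ x ∈ η.dom ∧ y ∈ η.dom) (fun x hx => ?_)
    (fun x y z hx hy hz => ?_) (fun x y _ _ ⟨η, h1, h2, h3⟩ => ⟨η, h1, h3, h2⟩) ht hs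
  · obtain ⟨η, h1, h2⟩ := A.exists_partialLift_near hπ a hx
    filter_upwards [mem_nhdsWithin_of_mem_nhds (η.isOpen_dom.mem_nhds h2)] with y hy
    exact ⟨η, h1, h2, hy⟩
  · rintro ⟨η, h1, h2, h3⟩ ⟨κ', h4', h5', h6'⟩
    -- Translating the second lift so that it meets `η` at `y` makes the two agree on the whole
    -- overlap, which is again an interval.
    obtain ⟨κ, hκd, h4, h5, hκy⟩ := h4'.exists_ractConst hπ h5' (h1.lifts y h3)
    have h6 : z ∈ κ.dom := hκd ▸ h6'
    have h7 : ∀ s (h3 : s ∈ η.dom) (h4 : s ∈ κ.dom), η.toFun ⟨s, h3⟩ = κ.toFun ⟨s, h4⟩ :=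
      fun s hs hs' => h1.eqOn hπ h4 h3 h5 hκy.symm hs hs'
    obtain ⟨θ, hd, hθ, hθe⟩ := exists_glue (A := A) hπ (fun b : Bool => if b then η else κ)
      (by rintro (_ | _) <;> simp [h1.horizontal, h4.horizontal])
      (by
        rintro (_ | _) (_ | _) s hi hj
        · rfl
        · exact (h7 s hj hi).symm
        · exact h7 s hi hj
        · rfl)
      (U := η.dom ∪ κ.dom) (by intro s; simp [or_comm])
      (IsPreconnected.union y h3 h5 η.preconnected_dom κ.preconnected_dom).ordConnected
      ⟨y, Or.inl h3⟩
    refine ⟨θ, ⟨hd.subset.trans (Set.union_subset h1.dom_subset h4.dom_subset), ?_, hθ⟩,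
      hd.symm ▸ Or.inl h2, hd.symm ▸ Or.inr h6⟩
    intro s hs
    have hs' : s ∈ η.dom ∪ κ.dom := hd ▸ hs
    rcases hs' with hs' | hs'
    · exact (congrArg π (hθe true s hs')).trans (h1.lifts s hs')
    · exact (congrArg π (hθe false s hs')).trans (h4.lifts s hs')

/-- For each `s` some partial lift reaches from `t` to `s`. Once all of them are normalized to take
the value `ξ` at `t`, they agree pairwise and glue over the full domain. -/
theorem existsUnique_horizontalLift (A : Connection G π) (hπ : IsPrincipalBundle G π)
    (a : SmoothPath X) {t : ℝ} (ht : t ∈ a.dom) {ξ : E} (hξ : π ξ = a.toFun ⟨t, ht⟩) :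
    ∃! η : SmoothPath E, A.IsHorizontalLift a t ξ η := by
  have h1 : ∀ s : a.dom, ∃ η, A.IsPartialLift a η ∧ (s : ℝ) ∈ η.dom ∧ ∃ ht : t ∈ η.dom,
      η.toFun ⟨t, ht⟩ = ξ := fun s => by
    obtain ⟨κ, h1, h2, h3⟩ := A.exists_partialLift_joining hπ a ht s.2
    obtain ⟨η, hd, h4, h5⟩ := h1.exists_ractConst hπ h2 hξ
    exact ⟨η, h4, hd ▸ h3, h5⟩
  choose κ hκ hs htκ hξκ using h1
  obtain ⟨η, hd, hη, hηe⟩ := exists_glue (A := A) hπ κ (fun s => (hκ s).horizontal)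
    (fun i j s hi hj => (hκ i).eqOn hπ (hκ j) (htκ i) (htκ j) ((hξκ i).trans (hξκ j).symm) hi hj)
    (U := a.dom) (fun s => ⟨fun h => ⟨⟨s, h⟩, hs ⟨s, h⟩⟩, fun ⟨i, hi⟩ => (hκ i).dom_subset hi⟩)
    a.ordConnected_dom ⟨t, ht⟩
  refine ⟨η, ⟨hd, fun s hsa => ?_, ⟨hd.symm ▸ ht, ?_⟩, hη⟩, fun η' h' => ?_⟩
  · exact (congrArg π (hηe ⟨s, hsa⟩ s (hs ⟨s, hsa⟩))).trans ((hκ ⟨s, hsa⟩).lifts s _)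
  · exact (hηe ⟨t, ht⟩ t (htκ _)).trans (hξκ _)
  · obtain ⟨ht', he'⟩ := h'.start
    refine IsHorizontal.ext hπ h'.horizontal hη (h'.dom_eq.trans hd.symm) (fun s h1 h2 => ?_) ht'
      (hd.symm ▸ ht) (he'.trans ((hηe ⟨t, ht⟩ t (htκ _)).trans (hξκ _)).symm)
    have hsa : s ∈ a.dom := hd ▸ h2
    refine (h'.lifts s hsa).trans ?_
    exact ((congrArg π (hηe ⟨s, hsa⟩ s (hs ⟨s, hsa⟩))).trans ((hκ ⟨s, hsa⟩).lifts s _)).symm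

end Connection

/-- A smooth map `ℝ → [0, 1]` which is `0` on `(-∞, 0]` and `1` on `[1, ∞)`. -/
noncomputable def cutoff (t : ℝ) : unitInterval :=
  ⟨Real.smoothTransition t, Real.smoothTransition.nonneg t, Real.smoothTransition.le_one t⟩

theorem dSmooth_cutoff : DSmooth cutoff := fun _ _ hp =>
  ContDiff.isPlot (X := ℝ) (Real.smoothTransition.contDiff.comp (IsPlot.contDiff (X := ℝ) hp))

theorem cutoff_of_nonpos {t : ℝ} (ht : t ≤ 0) : cutoff t = 0 :=
  Subtype.ext (Real.smoothTransition.zero_of_nonpos ht)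

theorem cutoff_of_one_le {t : ℝ} (ht : 1 ≤ t) : cutoff t = 1 :=
  Subtype.ext (Real.smoothTransition.one_of_one_le ht)

/-! ### Stationary paths as functions of a real parameter -/

namespace StPath

variable {X : Type*} [DiffeologicalSpace X]

/-- The value at `t : ℝ` of the extension of `α` by constants. -/
noncomputable def evalReal (α : StPath X) (t : ℝ) : X := α.1 (Set.projIcc 0 1 zero_le_one t)

theorem evalReal_coe (α : StPath X) (t : unitInterval) : α.evalReal t = α.1 t := by
  rw [evalReal, Set.projIcc_val]

theorem evalReal_of_mem (α : StPath X) {t : ℝ} (ht : t ∈ Set.Icc (0 : ℝ) 1) :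
    α.evalReal t = α.1 ⟨t, ht⟩ := α.evalReal_coe ⟨t, ht⟩

theorem evalReal_of_nonpos (α : StPath X) {t : ℝ} (ht : t ≤ 0) : α.evalReal t = α.source := by
  rw [evalReal, Set.projIcc_of_le_left _ ht]
  rfl

theorem evalReal_of_one_le (α : StPath X) {t : ℝ} (ht : 1 ≤ t) : α.evalReal t = α.target := by
  rw [evalReal, Set.projIcc_of_right_le _ ht]
  rfl

@[simp] theorem evalReal_zero (α : StPath X) : α.evalReal 0 = α.source :=
  α.evalReal_of_nonpos le_rfl

@[simp] theorem evalReal_one (α : StPath X) : α.evalReal 1 = α.target :=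
  α.evalReal_of_one_le le_rfl

theorem exists_stationary (α : StPath X) : ∃ e : ℝ, 0 < e ∧
    (∀ t ≤ e, α.evalReal t = α.source) ∧ ∀ t, 1 - e ≤ t → α.evalReal t = α.target := by
  obtain ⟨e, he, h0, h1⟩ := α.2
  refine ⟨e, he, fun t ht => h0 _ ?_, fun t ht => h1 _ ?_⟩
  · rw [Set.coe_projIcc]
    exact max_le he.le ((min_le_right _ _).trans ht)
  · rw [Set.coe_projIcc]
    exact le_max_of_le_right (le_min (by linarith) ht)

theorem evalReal_concat_of_lt (β α : StPath X) (h : α.target = β.source) {t : ℝ} (ht : t < 1 / 2) :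
    (β.concat α h).evalReal t = α.evalReal (2 * t) := by
  rcases le_total t 0 with h0 | h0
  · rw [evalReal_of_nonpos _ h0, evalReal_of_nonpos _ (by linarith), source_concat]
  · rw [evalReal_of_mem _ ⟨h0, by linarith⟩, evalReal_of_mem _ ⟨by linarith, by linarith⟩]
    change concatFun _ _ _ = _
    rw [concatFun, dif_pos ht]

theorem evalReal_concat_of_ge (β α : StPath X) (h : α.target = β.source) {t : ℝ}
    (ht : 1 / 2 ≤ t) : (β.concat α h).evalReal t = β.evalReal (2 * t - 1) := by
  rcases le_total 1 t with h0 | h0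
  · rw [evalReal_of_one_le _ h0, evalReal_of_one_le _ (by linarith), target_concat]
  · rw [evalReal_of_mem _ ⟨by linarith, h0⟩, evalReal_of_mem _ ⟨by linarith, by linarith⟩]
    change concatFun _ _ _ = _
    rw [concatFun, dif_neg (not_lt.mpr ht)]

theorem evalReal_reverse (α : StPath X) (t : ℝ) : α.reverse.evalReal t = α.evalReal (1 - t) := by
  rcases le_total t 0 with h0 | h0
  · rw [evalReal_of_nonpos _ h0, evalReal_of_one_le _ (by linarith), source_reverse]
  rcases le_total 1 t with h1 | h1
  · rw [evalReal_of_one_le _ h1, evalReal_of_nonpos _ (by linarith), target_reverse]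
  rw [evalReal_of_mem _ ⟨h0, h1⟩, evalReal_of_mem _ ⟨by linarith, by linarith⟩]
  rfl

protected theorem ext' {α β : StPath X} (h : ∀ t, α.1 t = β.1 t) : α = β := by
  obtain ⟨⟨f, hf⟩, h1⟩ := α
  obtain ⟨⟨g, hg⟩, h2⟩ := β
  obtain rfl : f = g := funext h
  rfl

@[simp] theorem reverse_reverse (α : StPath X) : α.reverse.reverse = α :=
  StPath.ext' fun t => by simp [reverse]

end StPath

namespace Connection

variable {X E G : Type*} [DiffeologicalSpace X] [DiffeologicalSpace E]
  [Group G] [DiffeologicalSpace G] [MulAction Gᵐᵒᵖ E] [SmoothRightAction G E] {π : E → X}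

/-! ### Parallel transport -/

/-- The horizontal lift of `α` that starts at `ξ` ends at `ξ'`. -/
def Transports (A : Connection G π) (α : StPath X) (ξ ξ' : E) : Prop :=
  ∃ (η : SmoothPath E) (h : A.IsHorizontalLift α.extend 0 ξ η),
    η.toFun ⟨1, h.dom_eq.symm ▸ Set.mem_univ _⟩ = ξ'

/-- Replacing the equation `η.dom = Set.univ` by totality of membership avoids transport along
domain equalities. -/
theorem transports_iff {A : Connection G π} {α : StPath X} {ξ ξ' : E} :
    A.Transports α ξ ξ' ↔ ∃ (η : SmoothPath E) (hd : ∀ s, s ∈ η.dom), A.IsHorizontal η ∧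
      (∀ s, π (η.toFun ⟨s, hd s⟩) = α.evalReal s) ∧ η.toFun ⟨0, hd 0⟩ = ξ ∧
      η.toFun ⟨1, hd 1⟩ = ξ' := by
  constructor
  · rintro ⟨η, h, h1⟩
    exact ⟨η, fun s => h.dom_eq.symm ▸ Set.mem_univ s, h.horizontal,
      fun s => h.lifts s (Set.mem_univ s), h.start.2, h1⟩
  · rintro ⟨η, hd, h1, h2, h3, h4⟩
    exact ⟨η, ⟨Set.eq_univ_of_forall hd, fun s _ => h2 s, ⟨hd 0, h3⟩, h1⟩, h4⟩

theorem exists_transports (A : Connection G π) (hπ : IsPrincipalBundle G π) (α : StPath X) {ξ : E}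
    (hξ : π ξ = α.source) : ∃ ξ', A.Transports α ξ ξ' := by
  obtain ⟨η, h, -⟩ := A.existsUnique_horizontalLift hπ α.extend (Set.mem_univ (0 : ℝ))
    (hξ.trans α.evalReal_zero.symm)
  exact ⟨_, η, h, rfl⟩

theorem Transports.proj_left {A : Connection G π} {α : StPath X} {ξ ξ' : E}
    (h : A.Transports α ξ ξ') : π ξ = α.source := by
  obtain ⟨η, hd, -, h2, rfl, -⟩ := transports_iff.mp h
  rw [h2, StPath.evalReal_zero]

theorem Transports.proj_right {A : Connection G π} {α : StPath X} {ξ ξ' : E}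
    (h : A.Transports α ξ ξ') : π ξ' = α.target := by
  obtain ⟨η, hd, -, h2, -, rfl⟩ := transports_iff.mp h
  rw [h2, StPath.evalReal_one]

theorem Transports.unique {A : Connection G π} (hπ : IsPrincipalBundle G π) {α : StPath X}
    {ξ ξ₁ ξ₂ : E} (h₁ : A.Transports α ξ ξ₁) (h₂ : A.Transports α ξ ξ₂) : ξ₁ = ξ₂ := by
  have hξ := h₁.proj_left.trans α.evalReal_zero.symm
  obtain ⟨η, h, rfl⟩ := h₁
  obtain ⟨κ, h', rfl⟩ := h₂
  obtain rfl := (A.existsUnique_horizontalLift hπ α.extend (Set.mem_univ (0 : ℝ)) hξ).unique h h'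
  rfl

theorem Transports.ract {A : Connection G π} (hπ : IsPrincipalBundle G π) {α : StPath X}
    {ξ ξ' : E} (h : A.Transports α ξ ξ') (g : G) :
    A.Transports α (DiffRecon.ract ξ g) (DiffRecon.ract ξ' g) := by
  obtain ⟨η, hd, h1, h2, rfl, rfl⟩ := transports_iff.mp h
  exact transports_iff.mpr ⟨η.ractConst g, hd, h1.ractConst g,
    fun s => (hπ.proj_ract _ _).trans (h2 s), rfl, rfl⟩

/-- A horizontal path is constant on intervals over which its projection is constant. -/
theorem IsHorizontal.eq_of_proj_constant {A : Connection G π} (hπ : IsPrincipalBundle G π)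
    {η : SmoothPath E} (hη : A.IsHorizontal η) {J : Set ℝ} (hJ : IsOpen J)
    (hJ' : J.OrdConnected) (hJη : J ⊆ η.dom) {x : X} (hx : ∀ s (h : s ∈ J), π (η.toFun ⟨s, hJη h⟩) = x)
    {t s : ℝ} (ht : t ∈ J) (hs : s ∈ J) : η.toFun ⟨s, hJη hs⟩ = η.toFun ⟨t, hJη ht⟩ := by
  let κ : SmoothPath E := ⟨J, hJ, hJ', fun _ => η.toFun ⟨t, hJη ht⟩, dSmooth_const⟩
  have hκ : A.IsHorizontal κ := A.isHorizontal_of_constant (t := t) ht fun _ => rfl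
  exact hη.eqOn hπ hκ hJ hJ' hJη subset_rfl
    (fun s h => (hx s h).trans (hx t ht).symm) ht rfl hs

/-- Since constant paths are horizontal, a lift does not move while its base path rests. Lifts are
thus stationary near both ends, which is what makes concatenations of them smooth. -/
theorem Transports.exists_stationary {A : Connection G π} (hπ : IsPrincipalBundle G π)
    {α : StPath X} {ξ ξ' : E} (h : A.Transports α ξ ξ') :
    ∃ (η : SmoothPath E) (hd : ∀ s, s ∈ η.dom), A.IsHorizontal η ∧
      (∀ s, π (η.toFun ⟨s, hd s⟩) = α.evalReal s) ∧ ∃ e > 0,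
      (∀ s ≤ e, η.toFun ⟨s, hd s⟩ = ξ ∧ α.evalReal s = α.source) ∧
      ∀ s, 1 - e ≤ s → η.toFun ⟨s, hd s⟩ = ξ' ∧ α.evalReal s = α.target := by
  obtain ⟨η, hd, h1, h2, rfl, rfl⟩ := transports_iff.mp h
  obtain ⟨e, he, h3, h4⟩ := α.exists_stationary
  -- Halving `e` places the closed half-lines of the conclusion inside the open ones on which
  -- horizontal paths are compared.
  refine ⟨η, hd, h1, h2, e / 2, by positivity, fun s hs => ⟨?_, h3 _ (by linarith)⟩,
    fun s hs => ⟨?_, h4 _ (by linarith)⟩⟩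
  · refine h1.eq_of_proj_constant hπ (J := Set.Iio e) isOpen_Iio Set.ordConnected_Iio
      (fun s _ => hd s) (x := α.source) (fun s hs => (h2 s).trans (h3 s hs.le)) he ?_
    exact lt_of_le_of_lt hs (by linarith)
  · refine h1.eq_of_proj_constant hπ (J := Set.Ioi (1 - e)) isOpen_Ioi Set.ordConnected_Ioi
      (fun s _ => hd s) (x := α.target) (fun s hs => (h2 s).trans (h4 s hs.le)) ?_ ?_
    · exact Set.mem_Ioi.mpr (by linarith)
    · exact Set.mem_Ioi.mpr (by linarith)

/-- Parallel transport can be computed on the open unit interval. -/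
theorem transports_of_Ioo {A : Connection G π} (hπ : IsPrincipalBundle G π) {α : StPath X}
    {ξ ξ' : E} {κ : SmoothPath E} (hκ : A.IsHorizontal κ) (hd : Set.Ioo 0 1 ⊆ κ.dom)
    (hp : ∀ s (hs : s ∈ Set.Ioo (0 : ℝ) 1), π (κ.toFun ⟨s, hd hs⟩) = α.evalReal s)
    (h0 : ∀ e > 0, ∃ (s : ℝ) (hs : s ∈ Set.Ioo (0 : ℝ) 1), s ≤ e ∧ κ.toFun ⟨s, hd hs⟩ = ξ)
    (h1 : ∀ e > 0, ∃ (s : ℝ) (hs : s ∈ Set.Ioo (0 : ℝ) 1), 1 - e ≤ s ∧ κ.toFun ⟨s, hd hs⟩ = ξ') :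
    A.Transports α ξ ξ' := by
  have hξ : π ξ = α.source := by
    obtain ⟨e, he, h2, -⟩ := α.exists_stationary
    obtain ⟨s, hs, hse, rfl⟩ := h0 e he
    rw [hp s hs, h2 s hse]
  obtain ⟨ζ, hζ⟩ := A.exists_transports hπ α hξ
  obtain ⟨η, hηd, hη, hηp, e, he, h2, h3⟩ := hζ.exists_stationary hπ
  -- The sample points are taken within the stationary ends of the global lift, where its values are
  -- already `ξ` and the end value `ζ`.
  obtain ⟨s, hs, hse, hsξ⟩ := h0 e he
  obtain ⟨u, hu, hue, huξ⟩ := h1 e he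
  have h4 := hη.eqOn hπ hκ isOpen_Ioo Set.ordConnected_Ioo (fun s _ => hηd s) hd
    (fun s hs => (hηp s).trans (hp s hs).symm) hs ((h2 s hse).1.trans hsξ.symm) hu
  rw [(h3 u hue).1, huξ] at h4
  rwa [← h4]

/-- The lift `η` of the concatenation exists anyway; by uniqueness it is `η₁(2s)` on the first half
and `η₂(2s - 1)` afterwards, so no lift has to be assembled by hand. -/
theorem Transports.concat {A : Connection G π} (hπ : IsPrincipalBundle G π) {α β : StPath X}
    {ξ₁ ξ₂ ξ₃ : E} (h₁ : A.Transports α ξ₁ ξ₂) (h₂ : A.Transports β ξ₂ ξ₃)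
    (h : α.target = β.source) : A.Transports (β.concat α h) ξ₁ ξ₃ := by
  obtain ⟨ζ, hζ⟩ := A.exists_transports hπ (β.concat α h) (h₁.proj_left.trans (by simp))
  suffices ζ = ξ₃ by rwa [← this]
  obtain ⟨η, hd, hη, hηp, e, he, h0, h1⟩ := hζ.exists_stationary hπ
  obtain ⟨η₁, hd₁, hη₁, hηp₁, e₁, he₁, h0₁, h1₁⟩ := h₁.exists_stationary hπ
  obtain ⟨η₂, hd₂, hη₂, hηp₂, e₂, he₂, h0₂, h1₂⟩ := h₂.exists_stationary hπ
  have hc₁ : ContDiff ℝ ∞ (fun t : ℝ => 2 * t) := contDiff_const.mul contDiff_id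
  have hc₂ : ContDiff ℝ ∞ (fun t : ℝ => 2 * t - 1) := hc₁.sub contDiff_const
  let f₁ := SmoothPath.ofContDiff _ hc₁ Set.univ isOpen_univ Set.ordConnected_univ
  let f₂ := SmoothPath.ofContDiff _ hc₂ Set.univ isOpen_univ Set.ordConnected_univ
  have hκ₁ := hη₁.reparam f₁ (fun s => hd₁ _) (Set.mem_univ 0)
  have hκ₂ := hη₂.reparam f₂ (fun s => hd₂ _) (Set.mem_univ 0)
  have e1 : ∀ s (hs : s ∈ Set.Iio (1 / 2 : ℝ)), η.toFun ⟨s, hd s⟩ = η₁.toFun ⟨2 * s, hd₁ _⟩ := by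
    intro s hs
    refine hη.eqOn hπ hκ₁ (J := Set.Iio (1 / 2 : ℝ)) isOpen_Iio Set.ordConnected_Iio
      (fun s _ => hd s) (fun s _ => Set.mem_univ s) (fun s hs => ?_) (t := 0) ?_ ?_ hs
    · rw [hηp]
      refine Eq.trans ?_ (hηp₁ _).symm
      exact StPath.evalReal_concat_of_lt β α h hs
    · exact Set.mem_Iio.mpr (by norm_num)
    · exact (h0 0 he.le).1.trans (h0₁ _ (show (2 * 0 : ℝ) ≤ e₁ by linarith)).1.symm
  -- The interval begins before `1 / 2`, where `α` already rests at its end point and `β` extends by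
  -- its starting point. The overlap with the first interval contains `1 / 2 - m`, at which both
  -- lifts equal `ξ₂`.
  have e2 : ∀ s (hs : s ∈ Set.Ioi (1 / 2 - e₁ / 2 : ℝ)),
      η.toFun ⟨s, hd s⟩ = η₂.toFun ⟨2 * s - 1, hd₂ _⟩ := by
    intro s hs
    let m := min (e₁ / 4) (1 / 4)
    have hm : 0 < m := by positivity
    have hm1 : m ≤ e₁ / 4 := min_le_left _ _
    refine hη.eqOn hπ hκ₂ (J := Set.Ioi (1 / 2 - e₁ / 2 : ℝ)) isOpen_Ioi Set.ordConnected_Ioi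
      (fun s _ => hd s) (fun s _ => Set.mem_univ s) (fun s hs => ?_) (t := 1 / 2 - m) ?_ ?_ hs
    · rw [hηp]
      refine Eq.trans ?_ (hηp₂ _).symm
      have hs' : 1 / 2 - e₁ / 2 < s := hs
      rcases lt_or_ge s (1 / 2) with h3 | h3
      · rw [StPath.evalReal_concat_of_lt _ _ _ h3, (h1₁ _ (by linarith)).2, h]
        exact (StPath.evalReal_of_nonpos _ (show 2 * s - 1 ≤ 0 by linarith)).symm
      · exact StPath.evalReal_concat_of_ge β α h h3
    · exact Set.mem_Ioi.mpr (by linarith)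
    · rw [e1 _ (Set.mem_Iio.mpr (by linarith)), (h1₁ _ (by linarith)).1]
      exact (h0₂ _ (show 2 * (1 / 2 - m) - 1 ≤ e₂ by linarith)).1.symm
  have h3 := e2 1 (Set.mem_Ioi.mpr (by linarith))
  rw [(h1 1 (by linarith)).1, (h1₂ _ (by linarith)).1] at h3
  exact h3

/-- The reparameterization axiom does not ask for monotonicity, so `t ↦ 1 - t` is allowed. -/
theorem Transports.reverse {A : Connection G π} {α : StPath X}
    {ξ ξ' : E} (h : A.Transports α ξ ξ') : A.Transports α.reverse ξ' ξ := by
  obtain ⟨η, hd, h1, h2, h3, h4⟩ := transports_iff.mp h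
  have hc : ContDiff ℝ ∞ (fun t : ℝ => 1 - t) := contDiff_const.sub contDiff_id
  let f := SmoothPath.ofContDiff _ hc Set.univ isOpen_univ Set.ordConnected_univ
  refine transports_iff.mpr ⟨η.reparam f fun s => hd _, Set.mem_univ,
    h1.reparam f _ (Set.mem_univ 0), fun s => ?_, ?_, ?_⟩
  · rw [StPath.evalReal_reverse]
    exact h2 _
  · rw [← h4]
    change η.toFun ⟨1 - 0, _⟩ = _
    simp
  · rw [← h3]
    change η.toFun ⟨1 - 1, _⟩ = _
    simp

/-- Transport is a total, single-valued relation over the starting fibre, so one implication forces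
the other. -/
theorem transports_iff_of_imp {A : Connection G π} (hπ : IsPrincipalBundle G π) {α β : StPath X}
    (hs : α.source = β.source) (h : ∀ ξ ξ', A.Transports α ξ ξ' → A.Transports β ξ ξ') (ξ ξ' : E) :
    A.Transports α ξ ξ' ↔ A.Transports β ξ ξ' := by
  refine ⟨h ξ ξ', fun h1 => ?_⟩
  obtain ⟨ζ, hζ⟩ := A.exists_transports hπ α (h1.proj_left.trans hs.symm)
  obtain rfl := h1.unique hπ (h _ _ hζ)
  exact hζ

/-- Continuity of a smooth self-map `f` of the unit interval at an end point `x`: there are interior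
points close to `x` whose images are close to `f x`. -/
theorem _root_.DiffRecon.exists_small_preimage {f : unitInterval → unitInterval} (hf : DSmooth f)
    {x : unitInterval} (hx : (x : ℝ) = 0 ∨ (x : ℝ) = 1) {e : ℝ} (he : 0 < e) :
    ∃ y : unitInterval, (y : ℝ) ∈ Set.Ioo (0 : ℝ) 1 ∧ |(y : ℝ) - x| ≤ e ∧ |(f y : ℝ) - f x| ≤ e := by
  -- Composition with `cutoff`, which fixes both end points, turns `f` into a smooth function on
  -- `ℝ`, for which continuity is available.
  have h1 : Continuous (fun t => (f (cutoff t) : ℝ)) :=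
    (DSmooth.contDiff (X := ℝ) (Y := ℝ) (dSmooth_val.comp (hf.comp dSmooth_cutoff))).continuous
  have h2 : Continuous (fun t => (cutoff t : ℝ)) := Real.smoothTransition.continuous
  have hlx : cutoff x = x := by
    refine Subtype.ext ?_
    rcases hx with hx | hx <;> simp [cutoff, hx]
  have h3 : ∀ᶠ t in 𝓝 (x : ℝ), dist (cutoff t : ℝ) (cutoff x) < e ∧ dist (f (cutoff t) : ℝ) (f (cutoff x)) < e :=
    ((Metric.tendsto_nhds.mp h2.continuousAt e he).and
      (Metric.tendsto_nhds.mp h1.continuousAt e he))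
  obtain ⟨d, hd, h4⟩ := Metric.eventually_nhds_iff.mp h3
  have h5 : ∃ t ∈ Set.Ioo (0 : ℝ) 1, dist t (x : ℝ) < d := by
    have hm : 0 < min (d / 2) (1 / 2) := by positivity
    have hm1 : min (d / 2) (1 / 2) ≤ d / 2 := min_le_left _ _
    have hm2 : min (d / 2) (1 / 2) ≤ 1 / 2 := min_le_right _ _
    rcases hx with hx | hx
    · refine ⟨min (d / 2) (1 / 2), ⟨hm, by linarith⟩, ?_⟩
      rw [hx, Real.dist_eq, sub_zero, abs_of_pos hm]
      linarith
    · refine ⟨1 - min (d / 2) (1 / 2), ⟨by linarith, by linarith⟩, ?_⟩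
      rw [hx, Real.dist_eq, sub_sub_cancel_left, abs_neg, abs_of_pos hm]
      linarith
  obtain ⟨t, ht, htd⟩ := h5
  have h6 := h4 htd
  rw [hlx] at h6
  exact ⟨cutoff t, ⟨Real.smoothTransition.pos_of_pos ht.1, Real.smoothTransition.lt_one_of_lt_one ht.2⟩,
    h6.1.le, h6.2.le⟩

/-- The lift of `α` is the lift of `α'` reparameterized by `f`. As `f` lives only on `[0, 1]`, it
gives a smooth path on `(0, 1)`, and the end values are recovered from continuity of `f` and
stationarity of the lift. -/
theorem Transports.comp {A : Connection G π} (hπ : IsPrincipalBundle G π) {α α' : StPath X}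
    {f : unitInterval → unitInterval} (hf : DSmooth f) (hf0 : f 0 = 0) (hf1 : f 1 = 1)
    (h : ∀ t, α.1 t = α'.1 (f t)) {ξ ξ' : E} (h' : A.Transports α' ξ ξ') : A.Transports α ξ ξ' := by
  obtain ⟨η, hd, h1, h2, e₀, he₀, h3, h4⟩ := h'.exists_stationary hπ
  let φ : SmoothPath ℝ :=
    { dom := Set.Ioo 0 1
      isOpen_dom := isOpen_Ioo
      ordConnected_dom := Set.ordConnected_Ioo
      toFun := fun s => (f ⟨s, Set.Ioo_subset_Icc_self s.2⟩ : ℝ)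
      smooth := fun n p hp => hf n (fun r => ⟨p r, Set.Ioo_subset_Icc_self (p r).2⟩) hp }
  have hκ := h1.reparam φ (fun s => hd _) (t := 1 / 2) (by constructor <;> norm_num)
  refine transports_of_Ioo hπ hκ subset_rfl (fun s hs => ?_) (fun e he => ?_) (fun e he => ?_)
  · refine (h2 _).trans ?_
    change α'.evalReal (f ⟨s, _⟩ : ℝ) = _
    rw [StPath.evalReal_coe, ← h, StPath.evalReal_of_mem]
  · obtain ⟨y, hy, h5, h6⟩ := exists_small_preimage hf (x := 0) (Or.inl rfl) (lt_min he he₀)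
    rw [hf0] at h6
    refine ⟨y, hy, ?_, (h3 _ ?_).1⟩
    · have := (abs_le.mp h5).2
      simp only [Set.Icc.coe_zero, sub_zero] at this
      exact this.trans (min_le_left _ _)
    · have := (abs_le.mp h6).2
      simp only [Set.Icc.coe_zero, sub_zero] at this
      exact this.trans (min_le_right _ _)
  · obtain ⟨y, hy, h5, h6⟩ := exists_small_preimage hf (x := 1) (Or.inr rfl) (lt_min he he₀)
    rw [hf1] at h6
    refine ⟨y, hy, ?_, (h4 _ ?_).1⟩
    · have := (abs_le.mp h5).1
      simp only [Set.Icc.coe_one] at this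
      linarith [min_le_left e e₀]
    · have h7 := (abs_le.mp h6).1
      simp only [Set.Icc.coe_one] at h7
      change 1 - e₀ ≤ (f y : ℝ)
      linarith [min_le_right e e₀]

/-- Transport along `η⁻` and then along `η` returns to the same point of the fibre, so inserting the
detour changes nothing. -/
theorem transports_retraceStep {A : Connection G π} (hπ : IsPrincipalBundle G π) {α β : StPath X}
    (h : RetraceStep α β) (ξ ξ' : E) : A.Transports α ξ ξ' ↔ A.Transports β ξ ξ' := by
  cases h with
  | reparam _ _ h =>
    obtain ⟨f, h0, h1, h⟩ := h
    refine (transports_iff_of_imp hπ ?_ (fun ξ ξ' => Transports.comp hπ f.smooth_toFun h0 h1 h)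
      ξ ξ').symm
    simp only [StPath.source, h, h0]
  | retrace α β η hα hβ =>
    refine transports_iff_of_imp hπ (by simp) (fun ξ ξ' h => ?_) ξ ξ'
    obtain ⟨ξ₁, h1⟩ := A.exists_transports hπ α (h.proj_left.trans (by simp))
    obtain ⟨ξ₂, h2⟩ := A.exists_transports hπ β
      (h1.proj_right.trans (hα.trans hβ))
    obtain ⟨ξ₃, h3⟩ := A.exists_transports hπ η.reverse (h1.proj_right.trans (by simpa using hα))
    have h4 : A.Transports η ξ₃ ξ₁ := by simpa using h3.reverse
    obtain rfl := h.unique hπ (h1.concat hπ h2 _)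
    exact ((h1.concat hπ h3 _).concat hπ h4 _).concat hπ h2 _

theorem transports_congr {A : Connection G π} (hπ : IsPrincipalBundle G π) {α β : StPath X}
    (h : Relation.EqvGen RetraceStep α β) (ξ ξ' : E) :
    A.Transports α ξ ξ' ↔ A.Transports β ξ ξ' := by
  induction h with
  | rel a b h => exact transports_retraceStep hπ h ξ ξ'
  | refl => exact Iff.rfl
  | symm _ _ _ ih => exact ih.symm
  | trans _ _ _ _ _ ih1 ih2 => exact ih1.trans ih2

end Connection

/-! ### Smooth dependence of parallel transport on parameters -/

namespace Connection

variable {X E G : Type*} [DiffeologicalSpace X] [DiffeologicalSpace E]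
  [Group G] [DiffeologicalSpace G] [MulAction Gᵐᵒᵖ E] [SmoothRightAction G E] {π : E → X}

/-- Smoothness in the parameter propagates in time. Near a time `s₀` the base family lifts to a
smooth family, and applying `A` gives a smooth family `θ` of horizontal paths. Uniqueness yields `η
r = θ r · g r` with `g` independent of time; smoothness at one time makes `g` smooth, and hence `η`
smooth at all nearby times. -/
theorem plotAt_horizontal {A : Connection G π} (hπ : IsPrincipalBundle G π) {n : ℕ}
    {c : Euc n × ℝ → X} (hc : DSmooth c) {r₀ : Euc n} {η : Euc n → SmoothPath E}
    (hd : ∀ r s, s ∈ (η r).dom)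
    (h : ∀ᶠ r in 𝓝 r₀, A.IsHorizontal (η r) ∧ ∀ s, π ((η r).toFun ⟨s, hd r s⟩) = c (r, s))
    (s t : ℝ) : PlotAt (fun r => (η r).toFun ⟨s, hd r s⟩) r₀ ↔
      PlotAt (fun r => (η r).toFun ⟨t, hd r t⟩) r₀ := by
  refine isPreconnected_univ.induction₂ (fun s t => PlotAt (fun r => (η r).toFun ⟨s, hd r s⟩) r₀ ↔
      PlotAt (fun r => (η r).toFun ⟨t, hd r t⟩) r₀) ?_
      (fun _ _ _ _ _ _ => Iff.trans) (fun _ _ _ _ => Iff.symm) (Set.mem_univ s) (Set.mem_univ t)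
  intro s₀ _
  obtain ⟨q, hq, hqc⟩ := hπ.exists_local_lift_prod hc (r₀, s₀)
  rw [nhds_prod_eq, Filter.eventually_prod_iff] at hqc
  obtain ⟨P, hP, Q, hQ, hPQ⟩ := hqc
  obtain ⟨e, he, hQe⟩ := Metric.eventually_nhds_iff_ball.mp hQ
  let K := Metric.ball s₀ e
  let κ : Euc n → SmoothPath E := fun r => SmoothPath.ofDSmooth (fun s => q (r, s))
    (hq.comp (DSmooth.prodMk dSmooth_const dSmooth_id')) K Metric.isOpen_ball
    (convex_ball s₀ e).ordConnected
  have hκ : IsPlot κ := fun r _ hs => ⟨Set.univ, K, isOpen_univ, trivial, Metric.isOpen_ball, hs,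
    fun _ _ => subset_rfl, hq.comp dSmooth_val⟩
  have hs₀ : s₀ ∈ K := Metric.mem_ball_self he
  let θ : Euc n → SmoothPath E := fun r => A.toFun ⟨(κ r, s₀), hs₀⟩
  have hθ : IsPlot θ := A.smooth n (fun r => ⟨(κ r, s₀), hs₀⟩) ⟨hκ, isPlot_const⟩
  have hθd : ∀ r s, s ∈ K → s ∈ (θ r).dom := fun r s hs => (A.dom_eq ⟨(κ r, s₀), hs₀⟩).symm ▸ hs
  have hθs : ∀ s (hs : s ∈ K), PlotAt (fun r => (θ r).toFun ⟨s, hθd r s hs⟩) r₀ := fun s hs =>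
    SmoothPath.plotAt_eval hθ r₀ fun r => hθd r s hs
  have hθp : ∀ᶠ r in 𝓝 r₀, ∀ s (hs : s ∈ K), π ((θ r).toFun ⟨s, hθd r s hs⟩) = c (r, s) := by
    filter_upwards [hP] with r hr s hs
    exact (A.lifting ⟨(κ r, s₀), hs₀⟩ s hs).trans (hPQ hr (hQe s hs))
  have main : ∀ x (hx : x ∈ K) y (hy : y ∈ K), PlotAt (fun r => (η r).toFun ⟨x, hd r x⟩) r₀ →
      PlotAt (fun r => (η r).toFun ⟨y, hd r y⟩) r₀ := by
    intro x hx y hy hxp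
    have h1 : ∀ r, ∃ g : G, π ((θ r).toFun ⟨x, hθd r x hx⟩) = π ((η r).toFun ⟨x, hd r x⟩) →
        (η r).toFun ⟨x, hd r x⟩ = ract ((θ r).toFun ⟨x, hθd r x hx⟩) g := fun r => by
      by_cases h2 : π ((θ r).toFun ⟨x, hθd r x hx⟩) = π ((η r).toFun ⟨x, hd r x⟩)
      · exact (hπ.exists_ract_eq h2).imp fun g hg _ => hg
      · exact ⟨1, fun h3 => absurd h3 h2⟩
    choose g hg using h1
    have hg' : ∀ᶠ r in 𝓝 r₀, (η r).toFun ⟨x, hd r x⟩ =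
        ract ((θ r).toFun ⟨x, hθd r x hx⟩) (g r) := by
      filter_upwards [h, hθp] with r hr hr'
      exact hg r ((hr' x hx).trans (hr.2 x).symm)
    have hgp : PlotAt g r₀ := hπ.plotAt_translation (hθs x hx) hxp hg'
    refine (((hθs y hy).prodMk hgp).comp_dSmooth
      (SmoothRightAction.smooth_ract (G := G) (E := E))).congr ?_
    filter_upwards [h, hθp, hg'] with r hr hr' hgr
    exact IsHorizontal.eqOn hπ ((A.isHorizontal_toFun _).ractConst (g r)) hr.1
      (J := K) Metric.isOpen_ball (convex_ball s₀ e).ordConnected (hθd r) (fun s _ => hd r s)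
      (fun s hs => (hπ.proj_ract _ _).trans ((hr' s hs).trans (hr.2 s).symm)) hx hgr.symm hy
  filter_upwards [mem_nhdsWithin_of_mem_nhds (Metric.ball_mem_nhds s₀ he)] with y hy
  exact ⟨main s₀ hs₀ y hy, main y hy s₀ hs₀⟩

/-- The width of the stationary ends of `q r` may vary with `r`, so extension by constants need not
be jointly smooth. Lifting `q r ∘ cutoff` instead gives a jointly smooth base family with the same
end points. Where transport fails, an irrelevant constant path keeps the family total. -/
theorem plotAt_transports {A : Connection G π} (hπ : IsPrincipalBundle G π) {n : ℕ}
    {q : Euc n → StPath X} (hq : IsPlot q) {ξ ξ' : Euc n → E} {r₀ : Euc n}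
    (h : ∀ᶠ r in 𝓝 r₀, A.Transports (q r) (ξ r) (ξ' r)) (hξ : PlotAt ξ r₀) : PlotAt ξ' r₀ := by
  have h1 : ∀ r, ∃ (η : SmoothPath E) (hd : ∀ s, s ∈ η.dom), A.Transports (q r) (ξ r) (ξ' r) →
      A.IsHorizontal η ∧ (∀ s, π (η.toFun ⟨s, hd s⟩) = (q r).1 (cutoff s)) ∧
      η.toFun ⟨0, hd 0⟩ = ξ r ∧ η.toFun ⟨1, hd 1⟩ = ξ' r := fun r => by
    by_cases h2 : A.Transports (q r) (ξ r) (ξ' r)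
    · obtain ⟨η, hd, h3, h4, h5, h6⟩ := transports_iff.mp h2
      let f := SmoothPath.ofContDiff Real.smoothTransition Real.smoothTransition.contDiff
        Set.univ isOpen_univ Set.ordConnected_univ
      refine ⟨η.reparam f fun s => hd _, Set.mem_univ, fun _ =>
        ⟨h3.reparam f _ (Set.mem_univ 0), fun s => ?_, ?_, ?_⟩⟩
      · exact (h4 _).trans ((q r).evalReal_coe (cutoff s))
      · rw [← h5]
        change η.toFun ⟨Real.smoothTransition 0, _⟩ = _
        simp
      · rw [← h6]
        change η.toFun ⟨Real.smoothTransition 1, _⟩ = _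
        simp
    · exact ⟨⟨Set.univ, isOpen_univ, Set.ordConnected_univ, fun _ => ξ r, dSmooth_const⟩,
        Set.mem_univ, fun h3 => absurd h3 h2⟩
  choose η hd hη using h1
  have hqs : DSmooth (fun z : Euc n × unitInterval => (q z.1).1 z.2) := hq
  have hc : DSmooth (fun z : Euc n × ℝ => (q z.1).1 (cutoff z.2)) :=
    hqs.comp (dSmooth_fst.prodMk (dSmooth_cutoff.comp dSmooth_snd))
  have h2 := plotAt_horizontal hπ hc (r₀ := r₀) hd
    (h.mono fun r hr => ⟨(hη r hr).1, (hη r hr).2.1⟩) 0 1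
  refine (h2.mp (hξ.congr ?_)).congr ?_
  · exact h.mono fun r hr => (hη r hr).2.2.1.symm
  · exact h.mono fun r hr => (hη r hr).2.2.2

end Connection

/-! ### Diffeomorphisms of the unit interval and the unit law -/

/-- A smooth function on `ℝ` with positive derivative which fixes `0` and `1` restricts to a
diffeomorphism of the unit interval. -/
theorem exists_diffeo_of_deriv_pos {f : ℝ → ℝ} (hf : ContDiff ℝ ∞ f) (hf' : ∀ t, 0 < deriv f t)
    (h0 : f 0 = 0) (h1 : f 1 = 1) :
    ∃ F : Diffeo unitInterval unitInterval, ∀ t, ((F t : unitInterval) : ℝ) = f t := by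
  have hm : StrictMono f := strictMono_of_deriv_pos hf'
  let φ : unitInterval → unitInterval := fun t =>
    ⟨f t, h0.symm.le.trans (hm.monotone t.2.1), (hm.monotone t.2.2).trans h1.le⟩
  have hφ : Function.Bijective φ := by
    refine ⟨fun s t h => Subtype.ext (hm.injective (congrArg Subtype.val h)), fun y => ?_⟩
    obtain ⟨t, ht, hty⟩ := intermediate_value_Icc zero_le_one hf.continuous.continuousOn
      (show (y : ℝ) ∈ Set.Icc (f 0) (f 1) by rw [h0, h1]; exact y.2)
    exact ⟨⟨t, ht⟩, Subtype.ext hty⟩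
  refine ⟨⟨Equiv.ofBijective φ hφ, fun n p hp => ?_, fun n p hp => ?_⟩, fun t => rfl⟩
  · exact ContDiff.isPlot (X := ℝ) (hf.comp (IsPlot.contDiff (X := ℝ) hp))
  · have hpc : ContDiff ℝ ∞ (fun r => (p r : ℝ)) := IsPlot.contDiff (X := ℝ) hp
    refine ContDiff.isPlot (X := ℝ)
      (p := fun r => (((Equiv.ofBijective φ hφ).symm (p r) : unitInterval) : ℝ)) ?_
    have hg : ∀ r, f ((Equiv.ofBijective φ hφ).symm (p r) : unitInterval) = p r := fun r =>
      congrArg Subtype.val ((Equiv.ofBijective φ hφ).apply_symm_apply (p r))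
    set g := (fun r => (((Equiv.ofBijective φ hφ).symm (p r) : unitInterval) : ℝ))
    replace hg : ∀ r, f (g r) = p r := hg
    -- The inverse function theorem for `f` on `ℝ` gives a smooth local inverse, which agrees with
    -- `g` by injectivity of `f`; end points of the interval need no separate treatment.
    refine contDiff_iff_contDiffAt.mpr fun r => ?_
    have hd : HasDerivAt f (deriv f (g r)) (g r) :=
      (hf.differentiable (by simp)).differentiableAt.hasDerivAt
    have hd' := hd.hasFDerivAt_equiv (hf' (g r)).ne'
    have hfa : ContDiffAt ℝ ∞ f (g r) := hf.contDiffAt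
    have hl := hfa.to_localInverse hd' (by simp)
    rw [hg r] at hl
    refine (ContDiffAt.comp r hl hpc.contDiffAt).congr_of_eventuallyEq ?_
    have hr := (hfa.hasStrictFDerivAt' hd' (by simp)).eventually_right_inverse
    rw [hg r] at hr
    filter_upwards [hpc.continuous.continuousAt.eventually hr] with y hy
    exact hm.injective ((hg y).trans hy.symm)

theorem deriv_smoothTransition_nonneg (t : ℝ) : 0 ≤ deriv Real.smoothTransition t :=
  Real.smoothTransition.monotone.deriv_nonneg

theorem deriv_smoothTransition_of_one_le {t : ℝ} (ht : 1 ≤ t) :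
    deriv Real.smoothTransition t = 0 := by
  refine IsLocalMax.deriv_eq_zero (Filter.Eventually.of_forall fun s => ?_)
  rw [Real.smoothTransition.one_of_one_le ht]
  exact Real.smoothTransition.le_one s

/-- Such an `F` realizes `const ∨ α` as `α ∘ F` when `α` rests on `[1 - e, 1]`: it runs at double
speed until the resting part and then only has to stay inside it. The function `f` switches by means
of `χ` from `2t` to the line `1 - e / 2 + (e / 2) t` through `(1, 1)`. -/
theorem exists_slowing_diffeo {e : ℝ} (he : 0 < e) (he' : e ≤ 1 / 2) :
    ∃ F : Diffeo unitInterval unitInterval, F 0 = 0 ∧ F 1 = 1 ∧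
      (∀ t : unitInterval, 2 * (t : ℝ) ≤ 1 - e → (F t : ℝ) = 2 * t) ∧
      ∀ t : unitInterval, 1 - e ≤ 2 * (t : ℝ) → 1 - e ≤ (F t : ℝ) := by
  let χ : ℝ → ℝ := fun t => Real.smoothTransition ((t - (1 - e) / 2) * (4 / e))
  let f : ℝ → ℝ := fun t => 2 * t + χ t * (1 - e / 2 - (2 - e / 2) * t)
  have hχ : ContDiff ℝ ∞ χ := Real.smoothTransition.contDiff.comp
    ((contDiff_id.sub contDiff_const).mul contDiff_const)
  have hf : ContDiff ℝ ∞ f := (contDiff_const.mul contDiff_id).add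
    (hχ.mul (contDiff_const.sub (contDiff_const.mul contDiff_id)))
  have hχ0 : ∀ t, t ≤ (1 - e) / 2 → χ t = 0 := fun t ht =>
    Real.smoothTransition.zero_of_nonpos
      (mul_nonpos_of_nonpos_of_nonneg (by linarith) (by positivity))
  have hlarge : ∀ t, 1 / 2 - e / 4 ≤ t → 1 ≤ (t - (1 - e) / 2) * (4 / e) := fun t ht => by
    rw [← mul_div_assoc, le_div_iff₀ he]
    linarith
  have hχ' : ∀ t, HasDerivAt χ
      (deriv Real.smoothTransition ((t - (1 - e) / 2) * (4 / e)) * (4 / e)) t := fun t => by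
    have h1 : HasDerivAt (fun t : ℝ => (t - (1 - e) / 2) * (4 / e)) (1 * (4 / e)) t :=
      ((hasDerivAt_id t).sub_const _).mul_const _
    have h2 := (Real.smoothTransition.contDiff (n := 1).differentiable
      (by simp)).differentiableAt (x := (t - (1 - e) / 2) * (4 / e)) |>.hasDerivAt
    have h3 := h2.comp t h1
    rwa [one_mul] at h3
  have hf' : ∀ t, 0 < deriv f t := fun t => by
    have h1 : HasDerivAt (fun t : ℝ => 1 - e / 2 - (2 - e / 2) * t) (-((2 - e / 2) * 1)) t :=
      ((hasDerivAt_id t).const_mul _).const_sub _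
    have h2 : HasDerivAt f _ t := ((hasDerivAt_id t).const_mul 2).add ((hχ' t).mul h1)
    rw [h2.deriv]
    -- The switch is complete at `1 / 2 - e / 4`, before `2t` overtakes the second line, so the term
    -- with the derivative of `χ` is nonnegative. What remains is at least `2 - (2 - e / 2) = e /
    -- 2`.
    have h3 : 0 ≤ deriv Real.smoothTransition ((t - (1 - e) / 2) * (4 / e)) * (4 / e) *
        (1 - e / 2 - (2 - e / 2) * t) := by
      rcases le_total (1 / 2 - e / 4) t with ht | ht
      · rw [deriv_smoothTransition_of_one_le (hlarge t ht)]
        simp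
      · refine mul_nonneg (mul_nonneg (deriv_smoothTransition_nonneg _) (by positivity)) ?_
        nlinarith
    have h4 : 0 ≤ χ t := Real.smoothTransition.nonneg _
    have h5 : χ t ≤ 1 := Real.smoothTransition.le_one _
    nlinarith
  have hf0 : f 0 = 0 := by simp [f, hχ0 0 (by linarith)]
  have hf1 : f 1 = 1 := by
    have : χ 1 = 1 := Real.smoothTransition.one_of_one_le (hlarge 1 (by linarith))
    simp only [f, this]
    ring
  have hsmall : ∀ t, 2 * t ≤ 1 - e → f t = 2 * t := fun t ht => by
    simp [f, hχ0 t (by linarith)]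
  obtain ⟨F, hF⟩ := exists_diffeo_of_deriv_pos hf hf' hf0 hf1
  refine ⟨F, Subtype.ext ((hF 0).trans hf0), Subtype.ext ((hF 1).trans hf1), fun t ht => ?_,
    fun t ht => ?_⟩
  · rw [hF, hsmall t ht]
  · rw [hF]
    have h1 := (strictMono_of_deriv_pos hf').monotone (show (1 - e) / 2 ≤ (t : ℝ) by linarith)
    rw [hsmall _ (by linarith)] at h1
    linarith

namespace StPath

variable {X : Type*} [DiffeologicalSpace X]

/-- The constant path. -/
def const (x : X) : StPath X := ⟨⟨fun _ => x, dSmooth_const⟩, 1, one_pos, fun _ _ => rfl,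
  fun _ _ => rfl⟩

@[simp] theorem source_const (x : X) : (const x).source = x := rfl

theorem isReparam_const_concat (α : StPath X) {x : X} (h : α.target = (const x).source) :
    IsReparam ((const x).concat α h) α := by
  obtain ⟨e₀, he₀, -, h1₀⟩ := α.exists_stationary
  have he : 0 < min e₀ (1 / 2) := by positivity
  have h1 : ∀ t, 1 - min e₀ (1 / 2) ≤ t → α.evalReal t = α.target := fun t ht =>
    h1₀ t (by linarith [min_le_left e₀ (1 / 2)])
  obtain ⟨F, hF0, hF1, h2, h3⟩ := exists_slowing_diffeo he (min_le_right _ _)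
  refine ⟨F, hF0, hF1, fun t => ?_⟩
  rw [← evalReal_coe, ← evalReal_coe]
  rcases lt_or_ge (t : ℝ) (1 / 2) with ht | ht
  · rw [evalReal_concat_of_lt _ _ _ ht]
    rcases le_total (2 * (t : ℝ)) (1 - min e₀ (1 / 2)) with h4 | h4
    · rw [h2 t h4]
    · rw [h1 _ h4, h1 _ (h3 t h4)]
  · rw [evalReal_concat_of_ge _ _ _ ht, h1 _ (h3 t (by linarith)), h]
    rfl

end StPath

/-- A pointed path is the product of another one with the same end point and of a loop. -/
theorem retrace_factor {X : Type*} [DiffeologicalSpace X] (α β : StPath X)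
    (h : α.target = β.target) :
    Relation.EqvGen RetraceStep α (β.concat (β.reverse.concat α (by simpa using h)) (by simp)) := by
  -- The retrace move inserts a detour between two paths, so a constant path is appended first to
  -- serve as the later one, and is removed again at the end.
  have h1 := α.isReparam_const_concat (x := α.target) (by simp)
  have h2 := RetraceStep.retrace α (StPath.const α.target) β h (by simpa using h.symm)
  have h3 := (β.concat (β.reverse.concat α (by simpa using h)) (by simp)).isReparam_const_concat
    (x := α.target) (by simpa using h.symm)
  exact (Relation.EqvGen.rel _ _ (RetraceStep.reparam _ _ h1)).symm.trans _ _ _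
    ((Relation.EqvGen.rel _ _ h2).trans _ _ _
      (Relation.EqvGen.rel _ _ (RetraceStep.reparam _ _ h3)))

/-! ### Smooth families of stationary paths -/

namespace StPath

variable {X : Type*} [DiffeologicalSpace X]

/-- A stationary path from `0` to `1` in the unit interval. -/
noncomputable def step : StPath unitInterval :=
  ⟨⟨fun t => cutoff (3 * t - 1), fun n p hp => dSmooth_cutoff n _ (ContDiff.isPlot (X := ℝ)
      ((contDiff_const.mul (IsPlot.contDiff (X := ℝ) hp)).sub contDiff_const))⟩, 1 / 3,
    by norm_num, fun t ht => (cutoff_of_nonpos (by linarith)).trans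
      (cutoff_of_nonpos (by simp)).symm,
    fun t ht => (cutoff_of_one_le (by linarith)).trans (cutoff_of_one_le (by norm_num)).symm⟩

theorem step_of_le {t : unitInterval} (ht : (t : ℝ) ≤ 1 / 3) : step.1 t = 0 :=
  cutoff_of_nonpos (by linarith)

@[simp] theorem source_step : step.source = 0 := step_of_le (by simp)

@[simp] theorem target_step : step.target = 1 :=
  cutoff_of_one_le (by norm_num)

/-- Concatenation of a fixed path with a smooth family of paths which are uniformly constant near
their starting points. -/
theorem isPlot_concat {n : ℕ} {q : Euc n → StPath X} (hq : IsPlot q) (α : StPath X)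
    (h : ∀ r, α.target = (q r).source) {d : ℝ} (hd : 0 < d)
    (hqd : ∀ r (t : unitInterval), (t : ℝ) ≤ d → (q r).1 t = α.target) :
    IsPlot (fun r => (q r).concat α (h r)) := by
  have hq' : DSmooth (fun z : Euc n × unitInterval => (q z.1).1 z.2) := hq
  obtain ⟨e, he, -, ha⟩ := α.2
  intro m w hw
  have hc : ContDiff ℝ ∞ (fun y => ((w y).2 : ℝ)) := IsPlot.contDiff (X := ℝ) hw.2
  refine DiffeologicalSpace.locality fun x => ?_
  rcases lt_trichotomy ((w x).2 : ℝ) (1 / 2) with ht | ht | ht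
  · refine ⟨_, isOpen_Iio.preimage hc.continuous, ht, fun {k f} hf hfs => ?_⟩
    have h2 : IsPlot (fun y => (⟨2 * ((w (f y)).2 : ℝ), by
        have h3 := (w (f y)).2.2.1; have h4 : ((w (f y)).2 : ℝ) < 1 / 2 := hf y
        constructor <;> linarith⟩ : unitInterval)) :=
      ContDiff.isPlot (X := ℝ) (contDiff_const.mul (hc.comp hfs))
    refine (congrArg (fun w => IsPlot w) (funext fun y => ?_)).mpr (α.1.smooth k _ h2)
    exact dif_pos (hf y)
  -- On this window around `1 / 2` all the concatenations are constant; the uniform `d` makes its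
  -- size independent of the parameter.
  · refine ⟨_, isOpen_Ioo.preimage hc.continuous,
      (⟨by linarith, by linarith⟩ : ((w x).2 : ℝ) ∈ Set.Ioo (1 / 2 - e / 2) (1 / 2 + d / 2)),
      fun {k f} hf hfs => ?_⟩
    refine (congrArg (fun w => IsPlot w) (funext fun y => ?_)).mpr (isPlot_const (x := α.target))
    have h3 : ((w (f y)).2 : ℝ) ∈ Set.Ioo (1 / 2 - e / 2) (1 / 2 + d / 2) := hf y
    change concatFun _ _ (w (f y)).2 = _
    rw [concatFun]
    split_ifs with h4
    · exact ha _ (by simp only; linarith [h3.1])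
    · exact hqd _ _ (by simp only; linarith [h3.2])
  · refine ⟨_, isOpen_Ioi.preimage hc.continuous, ht, fun {k f} hf hfs => ?_⟩
    have hm : ∀ y, 2 * ((w (f y)).2 : ℝ) - 1 ∈ unitInterval := fun y => by
      have h3 := (w (f y)).2.2.2
      have h4 : 1 / 2 < ((w (f y)).2 : ℝ) := hf y
      constructor <;> linarith
    have h2 : IsPlot (fun y => (⟨2 * ((w (f y)).2 : ℝ) - 1, hm y⟩ : unitInterval)) :=
      ContDiff.isPlot (X := ℝ) ((contDiff_const.mul (hc.comp hfs)).sub contDiff_const)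
    refine (congrArg (fun w => IsPlot w) (funext fun y => ?_)).mpr
      (hq' k (fun y => ((w (f y)).1, ⟨2 * ((w (f y)).2 : ℝ) - 1, hm y⟩)) ⟨isPlot_reparam hw.1 hfs, h2⟩)
    exact dif_neg (not_lt.mpr (le_of_lt (show 1 / 2 < ((w (f y)).2 : ℝ) from hf y)))

/-- The image of the segment from `r₀` to `r` under a plot. -/
noncomputable def ofPlot {n : ℕ} (p : Euc n → X) (hp : IsPlot p) (r₀ r : Euc n) : StPath X :=
  SmoothMap.slowed ⟨fun t => p (r₀ + (t : ℝ) • (r - r₀)), fun _ f hf =>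
    isPlot_reparam hp (f := fun y => r₀ + (f y : ℝ) • (r - r₀))
      (contDiff_const.add ((IsPlot.contDiff (X := ℝ) hf).smul contDiff_const))⟩ step

theorem ofPlot_apply {n : ℕ} (p : Euc n → X) (hp : IsPlot p) (r₀ r : Euc n) (t : unitInterval) :
    (ofPlot p hp r₀ r).1 t = p (r₀ + (step.1 t : ℝ) • (r - r₀)) := rfl

theorem ofPlot_of_le {n : ℕ} (p : Euc n → X) (hp : IsPlot p) (r₀ r : Euc n) {t : unitInterval}
    (ht : (t : ℝ) ≤ 1 / 3) : (ofPlot p hp r₀ r).1 t = p r₀ := by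
  rw [ofPlot_apply, step_of_le ht]
  simp

@[simp] theorem source_ofPlot {n : ℕ} (p : Euc n → X) (hp : IsPlot p) (r₀ r : Euc n) :
    (ofPlot p hp r₀ r).source = p r₀ := ofPlot_of_le p hp r₀ r (by simp)

@[simp] theorem target_ofPlot {n : ℕ} (p : Euc n → X) (hp : IsPlot p) (r₀ r : Euc n) :
    (ofPlot p hp r₀ r).target = p r := by
  have h : step.1 1 = 1 := target_step
  rw [target, ofPlot_apply, h]
  simp

theorem isPlot_ofPlot {n : ℕ} (p : Euc n → X) (hp : IsPlot p) (r₀ : Euc n) :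
    IsPlot (fun r => ofPlot p hp r₀ r) := by
  intro m w hw
  have h1 : ContDiff ℝ ∞ (fun y => (w y).1) := IsPlot.contDiff hw.1
  have h2 : ContDiff ℝ ∞ (fun y => (step.1 (w y).2 : ℝ)) :=
    IsPlot.contDiff (X := ℝ) (step.1.smooth m _ hw.2)
  exact isPlot_reparam hp (contDiff_const.add (h2.smul (h1.sub contDiff_const)))

theorem exists_of_pathConnected (hX : IsSmoothPathConnected X) (x y : X) :
    ∃ α : StPath X, α.source = x ∧ α.target = y := by
  obtain ⟨a, ⟨⟨s, hs⟩, rfl⟩, ⟨⟨t, ht⟩, rfl⟩⟩ := hX x y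
  refine ⟨(a.segment s t hs ht).slowed step, slowed_segment_source a s t hs ht step source_step, ?_⟩
  have h : step.1.toFun 1 = 1 := target_step
  simp [target, SmoothMap.slowed, SmoothPath.segment, h]

end StPath

namespace Connection

variable {X E G : Type*} [DiffeologicalSpace X] [DiffeologicalSpace E]
  [Group G] [DiffeologicalSpace G] [MulAction Gᵐᵒᵖ E] [SmoothRightAction G E] {π : E → X}

/-! ### Parallel transport of pointed path classes, and holonomy -/

theorem exists_endpoint (A : Connection G π) (hπ : IsPrincipalBundle G π) {x₀ : X} {ξ₀ : E}
    (hξ₀ : π ξ₀ = x₀) (c : PointedPaths x₀) :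
    ∃ ξ : E, ∀ α : StPath X, PathClass.mk α = c.1 → A.Transports α ξ₀ ξ := by
  obtain ⟨c, hc⟩ := c
  obtain ⟨α, rfl⟩ := Quotient.exists_rep c
  obtain ⟨ξ, hξ⟩ := A.exists_transports hπ α (hξ₀.trans hc.symm)
  exact ⟨ξ, fun β hβ => (transports_congr hπ (Quotient.exact hβ) _ _).mpr hξ⟩

/-- The end point of the horizontal lift at `ξ₀` of a class of paths. -/
noncomputable def endpoint (A : Connection G π) (hπ : IsPrincipalBundle G π) {x₀ : X} {ξ₀ : E}
    (hξ₀ : π ξ₀ = x₀) (c : PointedPaths x₀) : E := (A.exists_endpoint hπ hξ₀ c).choose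

theorem transports_endpoint (A : Connection G π) (hπ : IsPrincipalBundle G π) {x₀ : X} {ξ₀ : E}
    (hξ₀ : π ξ₀ = x₀) {α : StPath X} {c : PointedPaths x₀} (h : PathClass.mk α = c.1) :
    A.Transports α ξ₀ (A.endpoint hπ hξ₀ c) :=
  (A.exists_endpoint hπ hξ₀ c).choose_spec α h

theorem endpoint_eq (A : Connection G π) (hπ : IsPrincipalBundle G π) {x₀ : X} {ξ₀ ξ : E}
    (hξ₀ : π ξ₀ = x₀) {α : StPath X} {c : PointedPaths x₀} (h : PathClass.mk α = c.1)
    (hα : A.Transports α ξ₀ ξ) : A.endpoint hπ hξ₀ c = ξ :=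
  (A.transports_endpoint hπ hξ₀ h).unique hπ hα

theorem proj_endpoint (A : Connection G π) (hπ : IsPrincipalBundle G π) {x₀ : X} {ξ₀ : E}
    (hξ₀ : π ξ₀ = x₀) (c : PointedPaths x₀) : π (A.endpoint hπ hξ₀ c) = c.1.target := by
  obtain ⟨α, hα⟩ := Quotient.exists_rep c.1
  rw [(A.transports_endpoint hπ hξ₀ hα).proj_right, ← hα]
  rfl

theorem dSmooth_endpoint (A : Connection G π) (hπ : IsPrincipalBundle G π) {x₀ : X} {ξ₀ : E}
    (hξ₀ : π ξ₀ = x₀) : DSmooth (A.endpoint hπ hξ₀) := by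
  intro n p hp
  refine isPlot_of_plotAt fun r => ?_
  obtain ⟨q, hq, hpq⟩ := hp r
  exact plotAt_transports hπ hq
    (hpq.mono fun r hr => A.transports_endpoint hπ hξ₀ (c := p r) hr.symm)
    (isPlot_const.plotAt r)

theorem exists_holonomy (A : Connection G π) (hπ : IsPrincipalBundle G π) {x₀ : X} {ξ₀ : E}
    (hξ₀ : π ξ₀ = x₀) (c : LoopSpace x₀) :
    ∃ g : G, A.endpoint hπ hξ₀ ⟨c.1, c.2.1⟩ = ract ξ₀ g :=
  hπ.exists_ract_eq ((hξ₀.trans c.2.2.symm).trans (A.proj_endpoint hπ hξ₀ ⟨c.1, c.2.1⟩).symm)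

/-- The holonomy of a loop class. -/
noncomputable def holonomyFun (A : Connection G π) (hπ : IsPrincipalBundle G π) {x₀ : X} {ξ₀ : E}
    (hξ₀ : π ξ₀ = x₀) (c : LoopSpace x₀) : G := (A.exists_holonomy hπ hξ₀ c).choose

theorem endpoint_loop (A : Connection G π) (hπ : IsPrincipalBundle G π) {x₀ : X} {ξ₀ : E}
    (hξ₀ : π ξ₀ = x₀) (c : LoopSpace x₀) :
    A.endpoint hπ hξ₀ ⟨c.1, c.2.1⟩ = ract ξ₀ (A.holonomyFun hπ hξ₀ c) :=
  (A.exists_holonomy hπ hξ₀ c).choose_spec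

theorem transports_loop (A : Connection G π) (hπ : IsPrincipalBundle G π) {x₀ : X} {ξ₀ : E}
    (hξ₀ : π ξ₀ = x₀) (γ : StPath X) (hγ : γ.source = x₀ ∧ γ.target = x₀) :
    A.Transports γ ξ₀ (ract ξ₀ (A.holonomyFun hπ hξ₀ (LoopSpace.mk γ hγ))) := by
  rw [← A.endpoint_loop hπ hξ₀]
  exact A.transports_endpoint hπ hξ₀ rfl

theorem holonomyFun_eq (A : Connection G π) (hπ : IsPrincipalBundle G π) {x₀ : X} {ξ₀ : E}
    (hξ₀ : π ξ₀ = x₀) {γ : StPath X} (hγ : γ.source = x₀ ∧ γ.target = x₀) {g : G}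
    (h : A.Transports γ ξ₀ (ract ξ₀ g)) : A.holonomyFun hπ hξ₀ (LoopSpace.mk γ hγ) = g :=
  hπ.ract_left_injective ((A.transports_loop hπ hξ₀ γ hγ).unique hπ h)

/-- The holonomy representation of a connection. -/
noncomputable def holonomy (A : Connection G π) (hπ : IsPrincipalBundle G π) {x₀ : X} {ξ₀ : E}
    (hξ₀ : π ξ₀ = x₀) : LoopHom x₀ G where
  toFun := A.holonomyFun hπ hξ₀
  smooth := hπ.dSmooth_translation (p := fun _ => ξ₀) dSmooth_const
    ((A.dSmooth_endpoint hπ hξ₀).comp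
      (show DSmooth (fun c : LoopSpace x₀ => (⟨c.1, c.2.1⟩ : PointedPaths x₀)) from
        fun _ _ hp => hp)) (A.endpoint_loop hπ hξ₀)
  map_concat γ σ hγ hσ := by
    refine A.holonomyFun_eq hπ hξ₀ _ ?_
    rw [ract_mul]
    exact (A.transports_loop hπ hξ₀ σ hσ).concat hπ ((A.transports_loop hπ hξ₀ γ hγ).ract hπ _) _

theorem isHolonomy_holonomy (A : Connection G π) (hπ : IsPrincipalBundle G π) {x₀ : X} {ξ₀ : E}
    (hξ₀ : π ξ₀ = x₀) : A.IsHolonomy ξ₀ (A.holonomy hπ hξ₀) := fun γ hγ η hη =>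
  Transports.unique hπ ⟨η, hη, rfl⟩ (A.transports_loop hπ hξ₀ γ hγ)

/-! ### Reconstruction of the bundle -/

/-- Precomposing `α` with a loop `γ` multiplies its end point on the right by `H([γ])`, which
cancels against the factor `H([γ])⁻¹`. -/
theorem endpoint_assoc (A : Connection G π) (hπ : IsPrincipalBundle G π) {x₀ : X} {ξ₀ : E}
    (hξ₀ : π ξ₀ = x₀) {p q : PointedPaths x₀ × G}
    (h : Relation.EqvGen (AssocStep (A.holonomy hπ hξ₀)) p q) :
    ract (A.endpoint hπ hξ₀ p.1) p.2 = ract (A.endpoint hπ hξ₀ q.1) q.2 := by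
  induction h with
  | rel a b h =>
    cases h with
    | act α γ hα hγ g =>
      have h1 : A.Transports α ξ₀ (A.endpoint hπ hξ₀ (PointedPaths.mk α hα)) :=
        A.transports_endpoint hπ hξ₀ rfl
      have h2 := (A.transports_loop hπ hξ₀ γ hγ).concat hπ (h1.ract hπ _) (hγ.2.trans hα.symm)
      rw [A.endpoint_eq hπ hξ₀ rfl h2, ← ract_mul]
      congr 2
      exact mul_inv_cancel_left _ _
  | refl => rfl
  | symm _ _ _ ih => exact ih.symm
  | trans _ _ _ _ _ ih1 ih2 => exact ih1.trans ih2

/-- Equal images force `α` and `β` to have the same end point, so `γ = β⁻ ∨ α` is a loop, with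
holonomy `g' g⁻¹`. As `α` is retrace equivalent to `β ∨ γ`, the two pairs differ by a single step of
the relation. -/
theorem assoc_of_endpoint (A : Connection G π) (hπ : IsPrincipalBundle G π) {x₀ : X} {ξ₀ : E}
    (hξ₀ : π ξ₀ = x₀) {p q : PointedPaths x₀ × G}
    (h : ract (A.endpoint hπ hξ₀ p.1) p.2 = ract (A.endpoint hπ hξ₀ q.1) q.2) :
    Relation.EqvGen (AssocStep (A.holonomy hπ hξ₀)) p q := by
  obtain ⟨⟨c, hc⟩, g⟩ := p
  obtain ⟨⟨c', hc'⟩, g'⟩ := q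
  obtain ⟨α, rfl⟩ := Quotient.exists_rep c
  obtain ⟨β, rfl⟩ := Quotient.exists_rep c'
  have hs : α.source = x₀ := hc
  have hs' : β.source = x₀ := hc'
  have h1 : A.Transports α ξ₀ _ := A.transports_endpoint hπ hξ₀ (c := PointedPaths.mk α hs) rfl
  have h2 : A.Transports β ξ₀ _ := A.transports_endpoint hπ hξ₀ (c := PointedPaths.mk β hs') rfl
  replace h : ract (A.endpoint hπ hξ₀ (PointedPaths.mk α hs)) g =
    ract (A.endpoint hπ hξ₀ (PointedPaths.mk β hs')) g' := h
  generalize A.endpoint hπ hξ₀ (PointedPaths.mk α hs) = ξ at h1 h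
  generalize A.endpoint hπ hξ₀ (PointedPaths.mk β hs') = ξ' at h2 h
  have ht : α.target = β.target := by
    rw [← h1.proj_right, ← h2.proj_right, ← hπ.proj_ract ξ g, h, hπ.proj_ract]
  have hξ : ξ = ract ξ' (g' * g⁻¹) := by
    rw [ract_mul, ← h, ← ract_mul, mul_inv_cancel, ract_one]
  have hγ : (β.reverse.concat α (by simpa using ht)).source = x₀ ∧
      (β.reverse.concat α (by simpa using ht)).target = x₀ := by simp [hs, hs']
  have h3 : A.holonomyFun hπ hξ₀ (LoopSpace.mk _ hγ) = g' * g⁻¹ := by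
    refine A.holonomyFun_eq hπ hξ₀ hγ (h1.concat hπ ?_ _)
    rw [hξ]
    exact h2.reverse.ract hπ _
  have h4 := AssocStep.act (H := A.holonomy hπ hξ₀) β _ hs' hγ g'
  have h5 : ((A.holonomy hπ hξ₀).toFun (LoopSpace.mk _ hγ))⁻¹ * g' = g := by
    change (A.holonomyFun hπ hξ₀ (LoopSpace.mk _ hγ))⁻¹ * g' = g
    rw [h3]
    group
  rw [h5] at h4
  have h6 : (⟨Quotient.mk _ α, hc⟩ : PointedPaths x₀) = PointedPaths.mk
      (β.concat (β.reverse.concat α (by simpa using ht)) (by simp)) (by simpa using hs) :=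
    Subtype.ext (Quotient.sound (retrace_factor α β ht))
  rw [h6]
  exact Relation.EqvGen.rel _ _ h4

/-- The map `⟦[α], g⟧ ↦ hor(α, 0, ξ₀)(1) · g`. -/
noncomputable def ofAssoc (A : Connection G π) (hπ : IsPrincipalBundle G π) {x₀ : X} {ξ₀ : E}
    (hξ₀ : π ξ₀ = x₀) : Assoc (A.holonomy hπ hξ₀) → E :=
  Quotient.lift (fun p => ract (A.endpoint hπ hξ₀ p.1) p.2) fun _ _ h => A.endpoint_assoc hπ hξ₀ h

theorem ofAssoc_injective (A : Connection G π) (hπ : IsPrincipalBundle G π) {x₀ : X} {ξ₀ : E}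
    (hξ₀ : π ξ₀ = x₀) : Function.Injective (A.ofAssoc hπ hξ₀) := by
  rintro ⟨p⟩ ⟨q⟩ h
  exact Quotient.sound (A.assoc_of_endpoint hπ hξ₀ h)

theorem dSmooth_ofAssoc (A : Connection G π) (hπ : IsPrincipalBundle G π) {x₀ : X} {ξ₀ : E}
    (hξ₀ : π ξ₀ = x₀) : DSmooth (A.ofAssoc hπ hξ₀) := by
  intro n p hp
  refine isPlot_of_plotAt fun r => ?_
  obtain ⟨q, hq, hpq⟩ := hp r
  have h1 : IsPlot (fun r => ract (A.endpoint hπ hξ₀ (q r).1) (q r).2) :=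
    SmoothRightAction.smooth_ract n (fun r => (A.endpoint hπ hξ₀ (q r).1, (q r).2))
      ⟨A.dSmooth_endpoint hπ hξ₀ n _ hq.1, hq.2⟩
  refine (h1.plotAt r).congr (hpq.mono fun r hr => ?_)
  rw [Function.comp_apply, hr]
  rfl

/-- Plots of `E` lift locally to plots of pairs of a path class and a group element. -/
theorem exists_lift_assoc (A : Connection G π) (hπ : IsPrincipalBundle G π)
    (hX : IsSmoothPathConnected X) {x₀ : X} {ξ₀ : E} (hξ₀ : π ξ₀ = x₀) {n : ℕ} {p : Euc n → E}
    (hp : IsPlot p) (r₀ : Euc n) : ∃ q : Euc n → PointedPaths x₀ × G, IsPlot q ∧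
      ∀ r, A.ofAssoc hπ hξ₀ (Quotient.mk _ (q r)) = p r := by
  -- A fixed path to `π (p r₀)` followed by the image of the segment from `r₀` to `r` gives a smooth
  -- family of paths ending at `π (p r)`. Their lifts end in the right fibres, and the missing group
  -- factor is smooth.
  obtain ⟨α, hα, hα'⟩ := StPath.exists_of_pathConnected hX x₀ (π (p r₀))
  have hx : IsPlot (fun r => π (p r)) := hπ.smooth n p hp
  have hc : ∀ r, α.target = (StPath.ofPlot _ hx r₀ r).source := fun r => by simp [hα']
  have hβ : IsPlot (fun r => (StPath.ofPlot _ hx r₀ r).concat α (hc r)) :=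
    StPath.isPlot_concat (StPath.isPlot_ofPlot _ hx r₀) α hc (d := 1 / 3) (by norm_num)
      fun r t ht => by rw [StPath.ofPlot_of_le _ hx r₀ r ht, hα']
  let c : Euc n → PointedPaths x₀ := fun r =>
    PointedPaths.mk ((StPath.ofPlot _ hx r₀ r).concat α (hc r)) (by simpa using hα)
  have hcp : IsPlot c := fun r => ⟨_, hβ, Filter.Eventually.of_forall fun _ => rfl⟩
  have hg : ∀ r, ∃ g : G, p r = ract (A.endpoint hπ hξ₀ (c r)) g := fun r => by
    refine hπ.exists_ract_eq ((A.proj_endpoint hπ hξ₀ _).trans ?_)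
    change ((StPath.ofPlot _ hx r₀ r).concat α (hc r)).target = _
    simp
  choose g hg using hg
  have hgp : IsPlot g := (hπ.dSmooth_translation ((A.dSmooth_endpoint hπ hξ₀).comp hcp.dSmooth)
    hp.dSmooth hg).isPlot
  exact ⟨fun r => (c r, g r), ⟨hcp, hgp⟩, fun r => (hg r).symm⟩

theorem ofAssoc_surjective (A : Connection G π) (hπ : IsPrincipalBundle G π)
    (hX : IsSmoothPathConnected X) {x₀ : X} {ξ₀ : E} (hξ₀ : π ξ₀ = x₀) :
    Function.Surjective (A.ofAssoc hπ hξ₀) := fun ξ => by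
  obtain ⟨q, -, hq⟩ := A.exists_lift_assoc hπ hX hξ₀ (n := 0) (isPlot_const (x := ξ)) 0
  exact ⟨_, hq 0⟩

/-- The bijection between the associated bundle of the holonomy representation and the total
space. -/
noncomputable def assocEquiv (A : Connection G π) (hπ : IsPrincipalBundle G π)
    (hX : IsSmoothPathConnected X) {x₀ : X} {ξ₀ : E} (hξ₀ : π ξ₀ = x₀) :
    Assoc (A.holonomy hπ hξ₀) ≃ E :=
  Equiv.ofBijective _ ⟨A.ofAssoc_injective hπ hξ₀, A.ofAssoc_surjective hπ hX hξ₀⟩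

/-- The total space is diffeomorphic to the associated bundle of the holonomy representation. -/
noncomputable def assocDiffeo (A : Connection G π) (hπ : IsPrincipalBundle G π)
    (hX : IsSmoothPathConnected X) {x₀ : X} {ξ₀ : E} (hξ₀ : π ξ₀ = x₀) :
    Diffeo (Assoc (A.holonomy hπ hξ₀)) E where
  toEquiv := A.assocEquiv hπ hX hξ₀
  smooth_toFun := A.dSmooth_ofAssoc hπ hξ₀
  smooth_invFun n p hp := by
    refine isPlot_of_plotAt fun r₀ => ?_
    obtain ⟨q, hq, hqp⟩ := A.exists_lift_assoc hπ hX hξ₀ hp r₀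
    refine (IsPlot.plotAt (Assoc.dSmooth_mk _ n q hq) r₀).congr
      (Filter.Eventually.of_forall fun r => ?_)
    exact ((A.assocEquiv hπ hX hξ₀).symm_apply_apply _).symm.trans
      (congrArg (A.assocEquiv hπ hX hξ₀).symm (hqp r))

end Connection

/-! ### Transport of a connection along an isomorphism of bundles -/

section Pullback

variable {P X E G : Type*} [DiffeologicalSpace P] [DiffeologicalSpace X] [DiffeologicalSpace E]
  [Group G] [DiffeologicalSpace G]

theorem SmoothPath.dSmooth_map {f : P → E} (hf : DSmooth f) :
    DSmooth (fun a : SmoothPath P => a.map f hf) := by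
  intro n p hp r s hs
  obtain ⟨V, W, hV, hr, hW, hsW, h, hsm⟩ := hp r s hs
  exact ⟨V, W, hV, hr, hW, hsW, h, hf.comp hsm⟩

theorem InitPath.dSmooth_map {f : P → E} (hf : DSmooth f) :
    DSmooth (fun q : InitPath P => q.map f hf) := fun n p hp =>
  ⟨SmoothPath.dSmooth_map hf n (fun r => (p r).1.1) hp.1, hp.2⟩

theorem SmoothPath.map_map_of_leftInverse {f : P → E} {g : E → P} (hf : DSmooth f)
    (hg : DSmooth g) (h : ∀ x, g (f x) = x) (a : SmoothPath P) : (a.map f hf).map g hg = a :=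
  SmoothPath.ext' rfl fun _ _ _ => h _

variable [MulAction Gᵐᵒᵖ P] [SmoothRightAction G P] [MulAction Gᵐᵒᵖ E] [SmoothRightAction G E]

/-- The pullback of a connection along an equivariant diffeomorphism. -/
noncomputable def Connection.pullback {π : E → X} (A : Connection G π) (τ : P → X) (Φ : Diffeo P E)
    (hΦ : ∀ (z : P) (g : G), Φ (ract z g) = ract (Φ z) g) (hτ : ∀ z, π (Φ z) = τ z) :
    Connection G τ where
  toFun q := (A.toFun (q.map Φ Φ.smooth_toFun)).map Φ.invFun Φ.smooth_invFun
  smooth := (SmoothPath.dSmooth_map Φ.smooth_invFun).comp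
    (A.smooth.comp (InitPath.dSmooth_map Φ.smooth_toFun))
  dom_eq q := A.dom_eq _
  lifting q s hs := by
    rw [← hτ, ← hτ]
    refine Eq.trans (congrArg π ?_) (A.lifting (q.map Φ Φ.smooth_toFun) s hs)
    exact Φ.right_inv _
  basepoint q := by
    refine Eq.trans (congrArg Φ.invFun (A.basepoint (q.map Φ Φ.smooth_toFun))) ?_
    exact Φ.left_inv _
  equivariance a t ht ρ := by
    let ρ' : SmoothMap (a.map Φ Φ.smooth_toFun).dom G := ρ
    have h1 : (a.ract ρ).map Φ Φ.smooth_toFun = (a.map Φ Φ.smooth_toFun).ract ρ' :=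
      SmoothPath.ext' rfl fun s _ _ => hΦ _ _
    have h2 := (A.toFun_congr h1 ht ht).trans (A.equivariance (a.map Φ Φ.smooth_toFun) t ht ρ')
    refine (congrArg (fun b => b.map Φ.invFun Φ.smooth_invFun) h2).trans ?_
    refine SmoothPath.ext' rfl fun s _ _ => Φ.injective ?_
    exact (Φ.right_inv _).trans (Eq.trans (congrArg (fun y => ract y _) (Φ.right_inv _).symm)
      (hΦ _ _).symm)
  reparameterization a f hf t ht := congrArg (fun b => b.map Φ.invFun Φ.smooth_invFun)
    (A.reparameterization (a.map Φ Φ.smooth_toFun) f hf t ht)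
  projection q s hs := by
    have h1 := SmoothPath.map_map_of_leftInverse Φ.smooth_invFun Φ.smooth_toFun Φ.right_inv
      (A.toFun (q.map Φ Φ.smooth_toFun))
    have h2 := (A.toFun_congr h1 ((A.dom_eq _).symm ▸ hs) ((A.dom_eq _).symm ▸ hs)).trans
      (A.projection (q.map Φ Φ.smooth_toFun) s hs)
    exact congrArg (fun b => b.map Φ.invFun Φ.smooth_invFun) h2

theorem Connection.map_pullback {π : E → X} (A : Connection G π) (τ : P → X) (Φ : Diffeo P E)
    (hΦ : ∀ (z : P) (g : G), Φ (ract z g) = ract (Φ z) g) (hτ : ∀ z, π (Φ z) = τ z)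
    (q : InitPath P) : ((A.pullback τ Φ hΦ hτ).toFun q).map Φ Φ.smooth_toFun =
      A.toFun (q.map Φ Φ.smooth_toFun) :=
  SmoothPath.map_map_of_leftInverse Φ.smooth_invFun Φ.smooth_toFun Φ.right_inv _

end Pullback

/-- A horizontal path over `c` restricts to the horizontal lift of the slowed segments of `c`. -/
theorem Connection.transports_slowed_segment {X E G : Type*} [DiffeologicalSpace X]
    [DiffeologicalSpace E] [Group G] [DiffeologicalSpace G] [MulAction Gᵐᵒᵖ E]
    [SmoothRightAction G E] {π : E → X} {A : Connection G π} {η : SmoothPath E}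
    (hη : A.IsHorizontal η) (c : SmoothPath X) (hd : c.dom ⊆ η.dom)
    (hc : ∀ s (hs : s ∈ c.dom), π (η.toFun ⟨s, hd hs⟩) = c.toFun ⟨s, hs⟩) {r s : ℝ}
    (hr : r ∈ c.dom) (hs : s ∈ c.dom) {f : StPath unitInterval} (hf₀ : f.source = 0)
    (hf₁ : f.target = 1) :
    A.Transports ((c.segment r s hr hs).slowed f) (η.toFun ⟨r, hd hr⟩) (η.toFun ⟨s, hd hs⟩) := by
  have hmem : ∀ t : unitInterval, (t : ℝ) * s + (1 - t) * r ∈ c.dom := fun t => by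
    simpa only [smul_eq_mul] using c.ordConnected_dom.convex hs hr t.2.1 (sub_nonneg.mpr t.2.2)
      (add_sub_cancel (t : ℝ) 1)
  -- The slowed segment is `c ∘ φ`, with `φ` running from `r` to `s` inside the interval by
  -- convexity, so `η ∘ φ` is its horizontal lift.
  let φ : SmoothPath ℝ :=
    { dom := Set.univ
      isOpen_dom := isOpen_univ
      ordConnected_dom := Set.ordConnected_univ
      toFun := fun u => (f.evalReal u : ℝ) * s + (1 - f.evalReal u) * r
      smooth := fun n p hp => by
        have h1 : ContDiff ℝ ∞ (fun y => (f.evalReal (p y) : ℝ)) :=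
          IsPlot.contDiff (X := ℝ) (f.extend.smooth n p hp)
        exact ContDiff.isPlot (X := ℝ)
          ((h1.mul contDiff_const).add ((contDiff_const.sub h1).mul contDiff_const)) }
  refine Connection.transports_iff.mpr ⟨η.reparam φ fun u => hd (hmem _), Set.mem_univ,
    hη.reparam φ _ (Set.mem_univ 0), fun u => hc _ (hmem _), ?_, ?_⟩
  · change η.toFun ⟨(f.evalReal 0 : ℝ) * s + (1 - f.evalReal 0) * r, _⟩ = _
    simp [hf₀]
  · change η.toFun ⟨(f.evalReal 1 : ℝ) * s + (1 - f.evalReal 1) * r, _⟩ = _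
    simp [hf₁]

/-- After applying `Φ`, both sides are points of `E`. The path `A_r (Φ ∘ p)` is horizontal over `c`
and starts at `Φ (p r)`, so its value at `s` is the transport of that point along the segment, which
is also the transport of `ξ₀` along `β` and the segment, times `g`. -/
theorem Connection.isInducedUniversal_pullback {X E G : Type*} [DiffeologicalSpace X]
    [DiffeologicalSpace E] [Group G] [DiffeologicalSpace G] [DiffeologicalGroup G]
    [MulAction Gᵐᵒᵖ E] [SmoothRightAction G E] {π : E → X} (A : Connection G π)
    (hπ : IsPrincipalBundle G π) {x₀ : X} {ξ₀ : E} (hξ₀ : π ξ₀ = x₀)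
    (Φ : Diffeo (Assoc (A.holonomy hπ hξ₀)) E)
    (hΦ' : ∀ c g, Φ (Assoc.mk _ c g) = ract (A.endpoint hπ hξ₀ c) g)
    (hΦ : ∀ (z : Assoc (A.holonomy hπ hξ₀)) (g : G), Φ (ract z g) = ract (Φ z) g)
    (hτ : ∀ z, π (Φ z) = Assoc.proj _ z) :
    IsInducedUniversal (A.holonomy hπ hξ₀) (A.pullback (Assoc.proj _) Φ hΦ hτ) := by
  intro f hf₀ hf₁ p r hr β hβ g hp s hs
  refine Φ.injective ((Φ.right_inv _).trans ?_)
  refine Eq.trans ?_ (hΦ' _ _).symm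
  let c := p.map _ (Assoc.dSmooth_proj (A.holonomy hπ hξ₀))
  let q : InitPath E := InitPath.map ⟨(p, r), hr⟩ Φ Φ.smooth_toFun
  have hd : c.dom ⊆ (A.toFun q).dom := (A.dom_eq q).symm.subset
  have h1 : A.Transports ((c.segment r s hr hs).slowed f) ((A.toFun q).toFun ⟨r, hd hr⟩)
      ((A.toFun q).toFun ⟨s, hd hs⟩) := Connection.transports_slowed_segment
    (A.isHorizontal_toFun q) c hd (fun u hu => (A.lifting q u hu).trans (hτ _)) hr hs hf₀ hf₁
  have h2 : (A.toFun q).toFun ⟨r, hd hr⟩ =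
      ract (A.endpoint hπ hξ₀ (PointedPaths.mk β hβ)) g := by
    refine (A.basepoint q).trans ?_
    rw [← hΦ', ← hp]
    rfl
  rw [h2] at h1
  -- Transport along the segment starts at the end point of `β` times `g`; removing `g` allows
  -- concatenation with the transport along `β`, and `g` is restored afterwards.
  have h3 := h1.ract hπ g⁻¹
  rw [← ract_mul, mul_inv_cancel, ract_one] at h3
  have h4 := (A.transports_endpoint hπ hξ₀ (c := PointedPaths.mk β hβ) rfl).concat hπ h3
    (((congrArg (Assoc.proj _) hp).symm.trans
      (slowed_segment_source c r s hr hs f hf₀).symm))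
  rw [A.endpoint_eq hπ hξ₀ rfl h4, ← ract_mul, inv_mul_cancel, ract_one]
  rfl

end DiffRecon

/-! ### Reconstruction of the bundle and its connection from the holonomy -/

theorem mainTheorem2 {X E G : Type*} [DiffeologicalSpace X] [DiffeologicalSpace E]
    [Group G] [DiffeologicalSpace G] [DiffeologicalGroup G]
    [MulAction Gᵐᵒᵖ E] [SmoothRightAction G E]
    (π : E → X) (hX : IsSmoothPathConnected X) (hπ : IsPrincipalBundle G π)
    (x₀ : X) (ξ₀ : E) (hξ₀ : π ξ₀ = x₀) (A : Connection G π) :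
    -- horizontal lifts exist and are unique
    (∀ (a : SmoothPath X) (t : ℝ) (ht : t ∈ a.dom) (ξ : E), π ξ = a.toFun ⟨t, ht⟩ →
      ∃! η : SmoothPath E, A.IsHorizontalLift a t ξ η) ∧
    -- the holonomy representation
    ∃ H : LoopHom x₀ G, A.IsHolonomy ξ₀ H ∧
      ∃ Φ : Diffeo (Assoc H) E,
        -- `Φ ⟦[α], g⟧ = hor_A(α, 0, ξ₀)(1) · g`
        (∀ (α : StPath X) (hα : α.source = x₀) (g : G) (η : SmoothPath E)
          (hη : A.IsHorizontalLift α.extend 0 ξ₀ η),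
          Φ (Assoc.mk H (PointedPaths.mk α hα) g) =
            ract (η.toFun ⟨1, hη.dom_eq.symm ▸ Set.mem_univ _⟩) g) ∧
        (∀ (z : Assoc H) (g : G), Φ (ract z g) = ract (Φ z) g) ∧
        (∀ z : Assoc H, π (Φ z) = Assoc.proj H z) ∧
        -- the induced universal connection corresponds to `A`
        ∃ Θ : Connection G (Assoc.proj H), IsInducedUniversal H Θ ∧
          ∀ q : InitPath (Assoc H),
            (Θ.toFun q).map Φ Φ.smooth_toFun = A.toFun (q.map Φ Φ.smooth_toFun) := by
  have hΦ' : ∀ (c : PointedPaths x₀) (g : G), A.assocDiffeo hπ hX hξ₀ (Assoc.mk _ c g) =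
      ract (A.endpoint hπ hξ₀ c) g := fun _ _ => rfl
  have hΦ : ∀ (z : Assoc (A.holonomy hπ hξ₀)) (g : G), A.assocDiffeo hπ hX hξ₀ (ract z g) =
      ract (A.assocDiffeo hπ hX hξ₀ z) g := by
    rintro ⟨c, h⟩ g
    exact ract_mul _ _ _
  have hτ : ∀ z, π (A.assocDiffeo hπ hX hξ₀ z) = Assoc.proj _ z := by
    rintro ⟨c, h⟩
    exact (hπ.proj_ract _ _).trans (A.proj_endpoint hπ hξ₀ c)
  refine ⟨fun a t ht ξ hξ => A.existsUnique_horizontalLift hπ a ht hξ, A.holonomy hπ hξ₀,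
    A.isHolonomy_holonomy hπ hξ₀, A.assocDiffeo hπ hX hξ₀, fun α hα g η hη => ?_, hΦ, hτ,
    A.pullback _ _ hΦ hτ, A.isInducedUniversal_pullback hπ hξ₀ _ hΦ' hΦ hτ,
    A.map_pullback _ _ hΦ hτ⟩
  have h1 : A.endpoint hπ hξ₀ (PointedPaths.mk α hα) = _ :=
    A.endpoint_eq hπ hξ₀ rfl ⟨η, hη, rfl⟩
  rw [hΦ', h1]
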